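/- Let $V\in\mathcal D'(\mathbb R)$ be a complex-valued distribution, write $\langle Vu,u\rangle=\langle V,|u|^2\rangle$ for $u\in C_0^\infty(\mathbb R)$ (complex-valued test functions), $\|u\|_{W^1_2(\mathbb R)}^2=\|u'\|_{L_2(\mathbb R)}^2+\|u\|_{L_2(\mathbb R)}^2$, and let $W^{-1}_2(\mathbb R)$ be the dual space of $W^1_2(\mathbb R)$. Let $\eta\in C_0^\infty(\mathbb R)$ be any test function with $\eta(0)=1$. Then the following statements are equivalent. (i) $V$ is infinitesimally form bounded with respect to $-d^2/dx^2$: for every $\epsilon>0$ there exists $C(\epsilon)>0$ such that $$|\langle Vu,u\rangle|\le \epsilon\,\|u'\|_{L_2(\mathbb R)}^2+C(\epsilon)\,\|u\|_{L_2(\mathbb R)}^2\qquad\text{for all } u\in C_0^\infty(\mathbb R).$$ (ii) $V$ is form bounded with respect to $-d^2/dx^2$: there is a constant $C$ such that $|\langle Vu,u\rangle|\le C\,\|u\|_{W^1_2(\mathbb R)}^2$ for all $u\in C_0^\infty(\mathbb R)$. (iii) $V$ can be represented in the form $V=\frac{d\Gamma}{dx}+\gamma$ in the sense of distributions, where $\Gamma,\gamma$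 are measurable complex-valued functions on $\mathbb R$ with $$\sup_{x\in\mathbb R}\int_x^{x+1}\bigl(|\Gamma(t)|^2+|\gamma(t)|\bigr)\,dt<\infty.\qquad(*)$$ (iv) The distributions $$\Gamma(x)=\int_{\mathbb R}\operatorname{sign}(x-t)\,e^{-|x-t|}\,V(t)\,dt,\qquad \gamma(x)=\int_{\mathbb R}e^{-|x-t|}\,V(t)\,dt$$ exist and are functions satisfying $(*)$. Here, for a kernel $k$, the convolution $\int_{\mathbb R}k(x-t)V(t)\,dt$ is said to exist and to equal the distribution $T$ if, for every $\varphi\in C_0^\infty(\mathbb R)$ and every sequence $\eta_n\in C_0^\infty(\mathbb R)$ of real-valued functions that are bounded together with each derivative uniformly in $n$ and such that on each compact set $\eta_n=1$ for all large $n$, one has $\langle V,\eta_n\psi\rangle\to\langle T,\varphi\rangle$, where $\psi(t)=\int_{\mathbb R}k(x-t)\varphi(x)\,dx$. (v) $V$ belongs to the space $W^{-1}_2(\mathbb R,\mathrm{unif})$, i.e. $\sup_{x\in\mathbb R}\|\eta(x-\cdot)\,V\|_{W^{-1}_2(\mathbb R)}<\infty$. -/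

import Mathlib

open MeasureTheory Filter Topology TopologicalSpace
open scoped Distributions ENNReal LineDeriv

noncomputable section

namespace FormBounded

/-- Real-valued test functions: `C₀^∞(ℝ; ℝ)`. -/
abbrev RTest : Type := 𝓓((⊤ : Opens ℝ), ℝ)

/-- Complex-valued test functions: `C₀^∞(ℝ; ℂ)`. -/
abbrev CTest : Type := 𝓓((⊤ : Opens ℝ), ℂ)

/-- Complex-valued distributions on `ℝ` (continuous `ℝ`-linear maps `C₀^∞(ℝ; ℝ) → ℂ`). -/
abbrev Distr : Type := 𝓓'((⊤ : Opens ℝ), ℂ)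

/-- The test function `|u|²`. -/
def absSq (u : CTest) : RTest where
  toFun x := ‖u x‖ ^ 2
  contDiff' := u.contDiff.norm_sq ℝ
  hasCompactSupport' :=
    u.hasCompactSupport.comp_left (g := fun z : ℂ => ‖z‖ ^ 2) (by simp)
  tsupport_subset' := fun _ _ => trivial

/-- The quadratic form `⟨V u, u⟩ = ⟨V, u ū⟩ = "∫ |u|² V dx"`. -/
def quadForm (V : Distr) (u : CTest) : ℂ := V (absSq u)

/-- `‖u‖²` in `L₂(ℝ)`. -/
def l2Sq (u : CTest) : ℝ := ∫ x : ℝ, ‖u x‖ ^ 2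

/-- `‖u'‖²` in `L₂(ℝ)`. -/
def derivSq (u : CTest) : ℝ := ∫ x : ℝ, ‖deriv u x‖ ^ 2

/-- The norm of `W^1_2(ℝ)`, on test functions. -/
def sobolevNorm (u : CTest) : ℝ := Real.sqrt (derivSq u + l2Sq u)

/-- `V` is infinitesimally form bounded with respect to `-d²/dx²`. -/
def InfinitesimallyFormBounded (V : Distr) : Prop :=
  ∀ ε : ℝ, 0 < ε → ∃ C : ℝ, 0 < C ∧
    ∀ u : CTest, ‖quadForm V u‖ ≤ ε * derivSq u + C * l2Sq u

/-- `V` is form bounded with respect to `-d²/dx²`. -/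
def IsFormBounded (V : Distr) : Prop :=
  ∃ C : ℝ, ∀ u : CTest, ‖quadForm V u‖ ≤ C * sobolevNorm u ^ 2

/-- `Γ` and `γ` are measurable and `sup_x ∫_x^{x+1} (|Γ|² + |γ|) dt < ∞`. -/
def UnifLocBounded (Γ γ : ℝ → ℂ) : Prop :=
  AEStronglyMeasurable Γ volume ∧ AEStronglyMeasurable γ volume ∧
    (⨆ x : ℝ, ∫⁻ t in Set.Icc x (x + 1), (‖Γ t‖ₑ ^ 2 + ‖γ t‖ₑ)) < ∞

/-- The distribution `φ ↦ ∫ f φ dx` given by a locally integrable function `f`. (For `f` not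
locally integrable this is `0`, by convention; it is only used for locally integrable `f`.) -/
def ofFun (f : ℝ → ℂ) : Distr :=
  (TestFunction.integralAgainstBilinCLM (Ω := (⊤ : Opens ℝ)) (n := ⊤)
    (ContinuousLinearMap.lsmul ℝ ℝ : ℝ →L[ℝ] ℂ →L[ℝ] ℂ) volume f :
      RTest →L[ℝ] ℂ)

/-- For locally integrable `f`, the pairing of `ofFun f` with `φ` is the integral of `f φ`. -/
theorem ofFun_apply {f : ℝ → ℂ} (hf : LocallyIntegrable f) (φ : RTest) :
    ofFun f φ = ∫ x : ℝ, (φ x : ℂ) * f x := by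
  have h := TestFunction.integralAgainstBilinCLM_eq_integral (Ω := (⊤ : Opens ℝ)) (n := ⊤)
    (B := (ContinuousLinearMap.lsmul ℝ ℝ : ℝ →L[ℝ] ℂ →L[ℝ] ℂ)) (μ := volume) (φ := f)
    (hf.locallyIntegrableOn _) (f := φ)
  refine Eq.trans h ?_
  simp

/-- `V = dΓ/dx + γ` in the sense of distributions, with `(Γ, γ)` uniformly locally bounded as in
`UnifLocBounded` (so that both functions are locally integrable). -/
def HasRepresentation (V : Distr) : Prop :=
  ∃ Γ γ : ℝ → ℂ, UnifLocBounded Γ γ ∧ V = ∂_{(1 : ℝ)} (ofFun Γ) + ofFun γ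

/-- For a locally integrable kernel `k` and test functions `η`, `φ`, the test function
`t ↦ η(t) ∫ k(x - t) φ(x) dx`. -/
def cutoffConv (k : ℝ → ℝ) (hk : LocallyIntegrable k) (η φ : RTest) : RTest where
  toFun t := η t * ∫ x : ℝ, k (x - t) * φ x
  contDiff' := by
    have hk' : LocallyIntegrable (fun s : ℝ => k (-s)) := by
      rw [locallyIntegrable_iff] at hk ⊢
      intro K hK
      have h := hk (-K) hK.neg
      rw [← (Measure.measurePreserving_neg (volume : Measure ℝ)).integrableOn_comp_preimage
        (Homeomorph.neg ℝ).measurableEmbedding] at h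
      simpa [Function.comp_def] using h
    have h := φ.hasCompactSupport.contDiff_convolution_right
      (ContinuousLinearMap.mul ℝ ℝ) hk' φ.contDiff
    refine η.contDiff.mul (Eq.subst (motive := ContDiff ℝ _) (funext fun t => ?_) h)
    rw [convolution_def, ← integral_sub_left_eq_self (fun x : ℝ => k (x - t) * φ x) volume t]
    simp
  hasCompactSupport' := η.hasCompactSupport.mul_right
  tsupport_subset' := fun _ _ => trivial

/-- A sequence of test functions converging to `1` with all derivatives: on each compact set it is
eventually equal to `1`, and each derivative is bounded on `ℝ` uniformly in `n`. -/
def ConvergesToOne (η : ℕ → RTest) : Prop :=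
  (∀ K : Set ℝ, IsCompact K → ∀ᶠ n in atTop, ∀ x ∈ K, η n x = 1) ∧
    ∀ j : ℕ, ∃ C : ℝ, ∀ (n : ℕ) (x : ℝ), |iteratedDeriv j (η n) x| ≤ C

/-- The convolution `∫ k(x - t) V(t) dt` exists as a distribution, and is equal to `T`. That is,
`⟨T, φ⟩ = ⟨V, ∫ k(x - ·) φ(x) dx⟩` for every test function `φ`, where the right-hand side (in which
the second argument is smooth but need not have compact support) is the limit of
`⟨V, η_n ∫ k(x - ·) φ(x) dx⟩`, which has to exist for every sequence of cut-off functions `η_n`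
converging to `1`. -/
def IsConvolution (k : ℝ → ℝ) (hk : LocallyIntegrable k) (V T : Distr) : Prop :=
  ∀ (φ : RTest) (η : ℕ → RTest), ConvergesToOne η →
    Tendsto (fun n => V (cutoffConv k hk (η n) φ)) atTop (𝓝 (T φ))

/-- The kernel `e^{-|x|}`. -/
def expKernel (x : ℝ) : ℝ := Real.exp (-|x|)

/-- The kernel `sign(x) e^{-|x|}`. -/
def signExpKernel (x : ℝ) : ℝ := Real.sign x * Real.exp (-|x|)

theorem locallyIntegrable_expKernel : LocallyIntegrable expKernel :=
  Continuous.locallyIntegrable (by unfold expKernel; fun_prop)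

theorem locallyIntegrable_signExpKernel : LocallyIntegrable signExpKernel := by
  refine locallyIntegrable_expKernel.mono ?_ (Eventually.of_forall fun x => ?_)
  · have hs : Measurable Real.sign :=
      Measurable.ite measurableSet_Iio measurable_const
        (Measurable.ite measurableSet_Ioi measurable_const measurable_const)
    exact (hs.mul (by fun_prop)).aestronglyMeasurable
  · unfold signExpKernel expKernel
    rw [norm_mul]
    refine mul_le_of_le_one_left (norm_nonneg _) ?_
    rcases Real.sign_apply_eq x with h | h | h <;> simp [h]

/-- The distributions `Γ = ∫ sign(x - t) e^{-|x - t|} V(t) dt` and `γ = ∫ e^{-|x - t|} V(t) dt`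
exist, and are functions that satisfy the uniform local bound. -/
def ExplicitBounded (V : Distr) : Prop :=
  ∃ Γ γ : ℝ → ℂ, UnifLocBounded Γ γ ∧
    IsConvolution signExpKernel locallyIntegrable_signExpKernel V (ofFun Γ) ∧
    IsConvolution expKernel locallyIntegrable_expKernel V (ofFun γ)

/-- The pairing `⟨V, φ⟩` with a complex-valued test function `φ` (the `ℂ`-linear extension). -/
def pairing (V : Distr) (φ : CTest) : ℂ :=
  V (TestFunction.postcompCLM Complex.reCLM φ) +
    Complex.I * V (TestFunction.postcompCLM Complex.imCLM φ)

/-- The test function `y ↦ η(x - y) φ(y)`. -/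
def translateMul (η : CTest) (x : ℝ) (φ : CTest) : CTest where
  toFun y := η (x - y) * φ y
  contDiff' := (η.contDiff.comp (contDiff_const.sub contDiff_id)).mul φ.contDiff
  hasCompactSupport' := φ.hasCompactSupport.mul_left
  tsupport_subset' := fun _ _ => trivial

/-- The norm in `W^{-1}_2(ℝ)`, the dual space of `W^1_2(ℝ)`, of a functional on test functions
(it is `∞` for a functional that is not in `W^{-1}_2(ℝ)`). -/
def dualSobolevNorm (L : CTest → ℂ) : ℝ≥0∞ :=
  ⨆ (φ : CTest) (_ : sobolevNorm φ ≤ 1), ‖L φ‖ₑ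

/-- The norm `sup_x ‖η(x - ·) V‖` of `W^{-1}_2(ℝ, unif)`, where the product `η(x - ·) V` is the
distribution `φ ↦ ⟨V, η(x - ·) φ⟩`. -/
def unifNorm (η : CTest) (V : Distr) : ℝ≥0∞ :=
  ⨆ x : ℝ, dualSobolevNorm (fun φ => pairing V (translateMul η x φ))

/-- `V ∈ W^{-1}_2(ℝ, unif)`, the norm being taken with the test function `η`. -/
def MemUnif (η : CTest) (V : Distr) : Prop := unifNorm η V < ∞

end FormBounded

end

/-!
The cycle (form bounded) → (`V` in the uniform dual space) → (`V = Γ' + γ`) → (infinitesimally form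
bounded) → (form bounded) is closed, and the representation `V = Γ' + γ` is compared with the
explicit convolutions.

* A form bounded `V` is bounded on products of two test functions by polarization
  (`pairing_translateMul_eq`), and translates of `η` have a fixed Sobolev norm; this bounds
  `η(x - ·) V` in the dual norm uniformly in `x`.

* Conversely, by the Riesz representation theorem on the closed span of the pairs `(u, u')` in
  `L₂ × L₂`, each `η(k / N - ·) V`, for `k ∈ ℤ`, equals `g_k - h_k'` with `g_k`, `h_k` bounded in
  `L₂` uniformly in `k` (`exists_l2_representation`). As `η ≠ 0` near `0`, there is for some large
  `N` a test function `θ` such that the translates of `η θ` by multiples of `1 / N` add up to `1`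
  (`exists_div_stepBump`, `sum_stepBump`), hence `V = ∑ θ(k / N - ·) (g_k - h_k')`. This sum is
  locally finite, and the product rule puts it in the form `G - H'` with `G`, `H` uniformly locally
  square integrable.

* A weight `w` whose integrals over unit intervals are at most `M` satisfies `∫ f w ≤ M ∫ g` as
  soon as `f(t)` is at most the integral of `g` over `[t - 1, t]`
  (`lintegral_mul_le_of_le_average`). For `f = |u|²`, with the Sobolev inequality on unit
  intervals, this makes `w` infinitesimally form bounded, and
  `2 |Γ u u'| ≤ (ε / 2) |u'|² + (2 / ε) |Γ|² |u|²` reduces `Γ'` to the weight `|Γ|²`. For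
  `f = e^{-|x - ·|}` it makes the convolution of `w` with `e^{-|·|}` a bounded function.

* With `E = e^{-|·|}` and `S = sign E` one has `E' = -S` and `S' = 2δ - E`. Hence, for
  `V = Γ' + γ`, the convolutions are `S * V = 2 Γ - E * Γ + S * γ` and `E * V = -S * Γ + E * γ`,
  where everything but `2 Γ` is bounded; dominated convergence removes the cut-offs, and Fubini's
  theorem moves the kernels to the functions. In the other direction, `(S * V)' + E * V = 2 V`.
-/

namespace FormBounded

/-! ### Averaging over unit intervals -/

/-- A weight `w` with uniformly bounded integrals over unit intervals is dominated by Lebesgue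
measure on functions that are controlled by their averages over unit intervals (Tonelli). -/
theorem lintegral_mul_le_of_le_average {w f g : ℝ → ℝ≥0∞} {M : ℝ≥0∞} (hw : AEMeasurable w)
    (hM : ∀ x, ∫⁻ t in Set.Icc x (x + 1), w t ≤ M) (hg : Measurable g)
    (hf : ∀ t, f t ≤ ∫⁻ s in Set.Icc (t - 1) t, g s) :
    ∫⁻ t, f t * w t ≤ M * ∫⁻ s, g s := by
  have hmS : MeasurableSet {p : ℝ × ℝ | p.1 - 1 ≤ p.2 ∧ p.2 ≤ p.1} :=
    MeasurableSet.inter (s₁ := {p : ℝ × ℝ | p.1 - 1 ≤ p.2})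
      (s₂ := {p : ℝ × ℝ | p.2 ≤ p.1})
      (measurableSet_le (by fun_prop) (by fun_prop)) (measurableSet_le (by fun_prop) (by fun_prop))
  have hF : AEMeasurable (Function.uncurry fun t s : ℝ =>
      {p : ℝ × ℝ | p.1 - 1 ≤ p.2 ∧ p.2 ≤ p.1}.indicator (fun p => g p.2 * w p.1) (t, s))
      ((volume : Measure ℝ).prod volume) :=
    AEMeasurable.indicator ((hg.comp measurable_snd).aemeasurable.mul
      (hw.comp_quasiMeasurePreserving Measure.quasiMeasurePreserving_fst)) hmS
  calc ∫⁻ t, f t * w t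
      ≤ ∫⁻ t, ∫⁻ s, {p : ℝ × ℝ | p.1 - 1 ≤ p.2 ∧ p.2 ≤ p.1}.indicator
          (fun p => g p.2 * w p.1) (t, s) := by
        refine lintegral_mono fun t => ?_
        refine (mul_le_mul_left (hf t) _).trans (le_of_eq ?_)
        rw [← lintegral_mul_const _ hg, ← lintegral_indicator measurableSet_Icc]
        rfl
    _ = ∫⁻ s, ∫⁻ t, {p : ℝ × ℝ | p.1 - 1 ≤ p.2 ∧ p.2 ≤ p.1}.indicator
          (fun p => g p.2 * w p.1) (t, s) := lintegral_lintegral_swap hF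
    _ ≤ ∫⁻ s, M * g s := by
        refine lintegral_mono fun s => ?_
        have : ∀ t, {p : ℝ × ℝ | p.1 - 1 ≤ p.2 ∧ p.2 ≤ p.1}.indicator
            (fun p => g p.2 * w p.1) (t, s) = (Set.Icc s (s + 1)).indicator
              (fun t => g s * w t) t := by
          intro t
          simp only [Set.indicator_apply, Set.mem_ofPred_eq, Set.mem_Icc]
          congr 1
          simp only [eq_iff_iff]
          constructor <;> rintro ⟨h1, h2⟩ <;> constructor <;> linarith
        simp_rw [this]
        rw [lintegral_indicator measurableSet_Icc, lintegral_const_mul'' _ hw.restrict, mul_comm]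
        exact mul_le_mul_left (hM s) _
    _ = M * ∫⁻ s, g s := lintegral_const_mul _ hg

theorem UnifLocBounded.lintegral_le {Γ γ : ℝ → ℂ} (h : UnifLocBounded Γ γ) :
    ∃ M : ℝ, 0 ≤ M ∧
      ∀ x, ∫⁻ t in Set.Icc x (x + 1), (‖Γ t‖ₑ ^ 2 + ‖γ t‖ₑ) ≤ ENNReal.ofReal M :=
  ⟨_, ENNReal.toReal_nonneg, fun x => by
    rw [ENNReal.ofReal_toReal h.2.2.ne]
    exact le_iSup (fun x : ℝ => ∫⁻ t in Set.Icc x (x + 1), (‖Γ t‖ₑ ^ 2 + ‖γ t‖ₑ)) x⟩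

theorem unifLocBounded_of_le {Γ γ : ℝ → ℂ} (hΓ : AEStronglyMeasurable Γ volume)
    (hγ : AEStronglyMeasurable γ volume) {M : ℝ≥0∞} (hM : M ≠ ∞)
    (h : ∀ x, ∫⁻ t in Set.Icc x (x + 1), (‖Γ t‖ₑ ^ 2 + ‖γ t‖ₑ) ≤ M) : UnifLocBounded Γ γ :=
  ⟨hΓ, hγ, (iSup_le h).trans_lt hM.lt_top⟩

theorem locallyIntegrable_of_lintegral_Icc_lt_top {f : ℝ → ℂ} (hf : AEStronglyMeasurable f volume)
    (h : ∀ x, ∫⁻ t in Set.Icc x (x + 1), ‖f t‖ₑ < ∞) : LocallyIntegrable f := fun x =>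
  ⟨Set.Icc (x - 1 / 2) (x - 1 / 2 + 1), Icc_mem_nhds (by linarith) (by linarith),
    hf.restrict, h _⟩

theorem enorm_le_one_add_sq (z : ℂ) : ‖z‖ₑ ≤ 1 + ‖z‖ₑ ^ 2 := by
  rcases le_total ‖z‖ₑ 1 with h | h
  · exact h.trans le_self_add
  · calc ‖z‖ₑ = ‖z‖ₑ * 1 := (mul_one _).symm
      _ ≤ ‖z‖ₑ * ‖z‖ₑ := by gcongr
      _ ≤ 1 + ‖z‖ₑ ^ 2 := by rw [sq]; exact le_add_self

/-- Both functions are controlled by one weight with bounded integrals over unit intervals. -/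
theorem UnifLocBounded.exists_weight {Γ γ : ℝ → ℂ} (h : UnifLocBounded Γ γ) :
    ∃ w : ℝ → ℝ≥0∞, ∃ M : ℝ, 0 ≤ M ∧ AEMeasurable w ∧ (∀ t, ‖Γ t‖ₑ ≤ w t) ∧ (∀ t, ‖γ t‖ₑ ≤ w t) ∧
      ∀ x, ∫⁻ t in Set.Icc x (x + 1), w t ≤ ENNReal.ofReal M := by
  obtain ⟨M, hM0, hM⟩ := h.lintegral_le
  refine ⟨fun t => 1 + (‖Γ t‖ₑ ^ 2 + ‖γ t‖ₑ), 1 + M, by positivity, ?_, fun t => ?_, fun t => ?_,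
    fun x => ?_⟩
  · exact ((h.1.enorm.pow_const 2).add h.2.1.enorm).const_add 1
  · exact (enorm_le_one_add_sq _).trans (add_le_add_right le_self_add _)
  · exact le_add_self.trans le_add_self
  · rw [lintegral_add_left measurable_const, ENNReal.ofReal_add zero_le_one hM0]
    gcongr
    · simp
    · exact hM x

theorem UnifLocBounded.locallyIntegrable {Γ γ : ℝ → ℂ} (h : UnifLocBounded Γ γ) :
    LocallyIntegrable Γ ∧ LocallyIntegrable γ := by
  obtain ⟨w, M, -, -, h1, h2, hM⟩ := h.exists_weight
  exact ⟨locallyIntegrable_of_lintegral_Icc_lt_top h.1 fun x =>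
      (lintegral_mono h1).trans_lt ((hM x).trans_lt ENNReal.ofReal_lt_top),
    locallyIntegrable_of_lintegral_Icc_lt_top h.2.1 fun x =>
      (lintegral_mono h2).trans_lt ((hM x).trans_lt ENNReal.ofReal_lt_top)⟩

/-! ### Test functions -/

section TestFunctions

variable {F : Type*} [NormedAddCommGroup F] [NormedSpace ℝ F]

/-- A smooth compactly supported function on the line, bundled as a test function. -/
def testOf (f : ℝ → F) (hf : ContDiff ℝ ((⊤ : ℕ∞) : WithTop ℕ∞) f) (hc : HasCompactSupport f) :
    𝓓((⊤ : Opens ℝ), F) where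
  toFun := f
  contDiff' := hf
  hasCompactSupport' := hc
  tsupport_subset' := fun _ _ => trivial

@[simp] theorem testOf_apply (f : ℝ → F) (hf : ContDiff ℝ ((⊤ : ℕ∞) : WithTop ℕ∞) f)
    (hc : HasCompactSupport f) (x : ℝ) : testOf f hf hc x = f x := rfl

theorem differentiable_test (u : 𝓓((⊤ : Opens ℝ), F)) : Differentiable ℝ u :=
  u.contDiff.differentiable (by simp)

theorem continuous_deriv_test (u : 𝓓((⊤ : Opens ℝ), F)) : Continuous (deriv u) :=
  u.contDiff.continuous_deriv (by simp)

theorem lineDeriv_test_apply (φ : RTest) (x : ℝ) : (∂_{(1 : ℝ)} φ) x = deriv φ x := by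
  rw [TestFunction.lineDerivOp_eq_lineDerivCLM ℝ, TestFunction.lineDerivCLM_apply_of_le (by simp),
    (differentiable_test φ x).lineDeriv_eq_fderiv, fderiv_apply_one_eq_deriv]

theorem integrable_sq_norm (u : 𝓓((⊤ : Opens ℝ), F)) : Integrable fun x => ‖u x‖ ^ 2 := by
  have h : Continuous fun x => ‖u x‖ ^ 2 := u.continuous.norm.pow 2
  have hc : HasCompactSupport fun x => ‖u x‖ ^ 2 :=
    u.hasCompactSupport.comp_left (g := fun z : F => ‖z‖ ^ 2) (by simp)
  exact h.integrable_of_hasCompactSupport hc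

theorem integrable_sq_norm_deriv (u : 𝓓((⊤ : Opens ℝ), F)) :
    Integrable fun x => ‖deriv u x‖ ^ 2 := by
  have h : Continuous fun x => ‖deriv u x‖ ^ 2 := (continuous_deriv_test u).norm.pow 2
  have hc : HasCompactSupport fun x => ‖deriv u x‖ ^ 2 :=
    u.hasCompactSupport.deriv.comp_left (g := fun z : F => ‖z‖ ^ 2) (by simp)
  exact h.integrable_of_hasCompactSupport hc

end TestFunctions

@[simp] theorem absSq_apply (u : CTest) (x : ℝ) : absSq u x = ‖u x‖ ^ 2 := rfl

theorem l2Sq_nonneg (u : CTest) : 0 ≤ l2Sq u := integral_nonneg fun _ => by positivity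

theorem derivSq_nonneg (u : CTest) : 0 ≤ derivSq u := integral_nonneg fun _ => by positivity

theorem sobolevNorm_sq (u : CTest) : sobolevNorm u ^ 2 = derivSq u + l2Sq u :=
  Real.sq_sqrt (add_nonneg (derivSq_nonneg u) (l2Sq_nonneg u))

/-- The pairing of `dΓ/dx + γ` with a test function. -/
theorem representation_apply {Γ γ : ℝ → ℂ} (h : UnifLocBounded Γ γ) (φ : RTest) :
    (∂_{(1 : ℝ)} (ofFun Γ) + ofFun γ) φ =
      -(∫ x : ℝ, ((deriv φ x : ℝ) : ℂ) * Γ x) + ∫ x : ℝ, (φ x : ℂ) * γ x := by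
  have h1 : (∂_{(1 : ℝ)} (ofFun Γ) + ofFun γ) φ = -(ofFun Γ (∂_{(1 : ℝ)} φ)) + ofFun γ φ := by
    rw [← map_neg, ← Distribution.lineDerivOp_apply_apply]
    rfl
  rw [h1, ofFun_apply h.locallyIntegrable.1, ofFun_apply h.locallyIntegrable.2]
  simp_rw [lineDeriv_test_apply]

/-! ### From a representation to infinitesimal form boundedness -/

theorem hasDerivAt_absSq (u : CTest) (x : ℝ) :
    HasDerivAt (absSq u) (2 * inner ℝ (u x) (deriv u x)) x :=
  ((differentiable_test u x).hasDerivAt).norm_sq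

theorem abs_deriv_absSq_le (u : CTest) (x : ℝ) :
    |deriv (absSq u) x| ≤ 2 * (‖u x‖ * ‖deriv u x‖) := by
  rw [(hasDerivAt_absSq u x).deriv, abs_mul, abs_two]
  gcongr
  exact abs_real_inner_le_norm _ _

/-- One-dimensional Sobolev inequality with a small constant in front of the derivative, localized
to a unit interval. -/
theorem sq_norm_le_integral (u : CTest) {ε : ℝ} (hε : 0 < ε) (t : ℝ) :
    ‖u t‖ ^ 2 ≤ ∫ s in Set.Icc (t - 1) t, (ε * ‖deriv u s‖ ^ 2 + (1 + 1 / ε) * ‖u s‖ ^ 2) := by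
  -- The factor `s - (t - 1)` vanishes at the left endpoint and equals `1` at `t`.
  have hd : ∀ s, HasDerivAt (fun s => (s - (t - 1)) * absSq u s)
      (1 * absSq u s + (s - (t - 1)) * deriv (absSq u) s) s := fun s =>
    ((hasDerivAt_id s).sub_const (t - 1)).mul (differentiable_test (absSq u) s).hasDerivAt
  have hc1 : Continuous fun s => 1 * absSq u s + (s - (t - 1)) * deriv (absSq u) s :=
    ((absSq u).continuous.const_mul 1).add
      ((continuous_id.sub continuous_const).mul (continuous_deriv_test (absSq u)))
  have hc2 : Continuous fun s => ε * ‖deriv u s‖ ^ 2 + (1 + 1 / ε) * ‖u s‖ ^ 2 :=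
    (((continuous_deriv_test u).norm.pow 2).const_mul ε).add ((u.continuous.norm.pow 2).const_mul _)
  have hftc := intervalIntegral.integral_eq_sub_of_hasDerivAt (a := t - 1) (b := t)
    (fun s _ => hd s) (hc1.intervalIntegrable _ _)
  have : ‖u t‖ ^ 2 = ∫ s in (t - 1)..t,
      (1 * absSq u s + (s - (t - 1)) * deriv (absSq u) s) := by
    rw [hftc]; simp
  rw [this, integral_Icc_eq_integral_Ioc, ← intervalIntegral.integral_of_le (by linarith)]
  refine intervalIntegral.integral_mono_on (by linarith) (hc1.intervalIntegrable _ _)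
    (hc2.intervalIntegrable _ _) fun s hs => ?_
  have h1 : (s - (t - 1)) * deriv (absSq u) s ≤ 2 * (‖u s‖ * ‖deriv u s‖) := by
    refine (le_abs_self _).trans ?_
    rw [abs_mul]
    have : |s - (t - 1)| ≤ 1 := abs_le.2 ⟨by linarith [hs.1], by linarith [hs.2]⟩
    exact (mul_le_of_le_one_left (abs_nonneg _) this).trans (abs_deriv_absSq_le u s)
  have h2 : 2 * (‖u s‖ * ‖deriv u s‖) ≤ ε * ‖deriv u s‖ ^ 2 + 1 / ε * ‖u s‖ ^ 2 := by
    have := sq_nonneg (ε * ‖deriv u s‖ - ‖u s‖)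
    have h3 : ε * ‖deriv u s‖ ^ 2 + 1 / ε * ‖u s‖ ^ 2 - 2 * (‖u s‖ * ‖deriv u s‖)
      = 1 / ε * (ε * ‖deriv u s‖ - ‖u s‖) ^ 2 := by field_simp; ring
    have h4 : 0 ≤ 1 / ε * (ε * ‖deriv u s‖ - ‖u s‖) ^ 2 := by positivity
    linarith
  rw [absSq_apply]
  linarith

theorem integral_sobolev (u : CTest) (a b : ℝ) :
    ∫ s, (a * ‖deriv u s‖ ^ 2 + b * ‖u s‖ ^ 2) = a * derivSq u + b * l2Sq u := by
  rw [integral_add ((integrable_sq_norm_deriv u).const_mul a) ((integrable_sq_norm u).const_mul b),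
    integral_const_mul, integral_const_mul]
  rfl

/-- A weight with bounded integrals over unit intervals is infinitesimally form bounded. -/
theorem lintegral_weight_mul_sq_le {w : ℝ → ℝ≥0∞} {M : ℝ} (hM0 : 0 ≤ M) (hw : AEMeasurable w)
    (hM : ∀ x, ∫⁻ t in Set.Icc x (x + 1), w t ≤ ENNReal.ofReal M) (u : CTest) {ε : ℝ}
    (hε : 0 < ε) :
    ∫⁻ t, ENNReal.ofReal (‖u t‖ ^ 2) * w t ≤
      ENNReal.ofReal (M * (ε * derivSq u + (1 + 1 / ε) * l2Sq u)) := by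
  have hc : Continuous fun s => ε * ‖deriv u s‖ ^ 2 + (1 + 1 / ε) * ‖u s‖ ^ 2 :=
    (((continuous_deriv_test u).norm.pow 2).const_mul ε).add ((u.continuous.norm.pow 2).const_mul _)
  have hpos : ∀ s, 0 ≤ ε * ‖deriv u s‖ ^ 2 + (1 + 1 / ε) * ‖u s‖ ^ 2 := fun s => by positivity
  have hi : Integrable fun s => ε * ‖deriv u s‖ ^ 2 + (1 + 1 / ε) * ‖u s‖ ^ 2 :=
    ((integrable_sq_norm_deriv u).const_mul _).add ((integrable_sq_norm u).const_mul _)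
  refine (lintegral_mul_le_of_le_average hw hM
    (g := fun s => ENNReal.ofReal (ε * ‖deriv u s‖ ^ 2 + (1 + 1 / ε) * ‖u s‖ ^ 2))
    (ENNReal.measurable_ofReal.comp hc.measurable) fun t => ?_).trans (le_of_eq ?_)
  · rw [← ofReal_integral_eq_lintegral_ofReal hi.integrableOn (ae_of_all _ hpos)]
    exact ENNReal.ofReal_le_ofReal (sq_norm_le_integral u hε t)
  · rw [← ofReal_integral_eq_lintegral_ofReal hi (ae_of_all _ hpos), integral_sobolev,
      ENNReal.ofReal_mul hM0]

theorem HasRepresentation.infinitesimallyFormBounded {V : Distr} (h : HasRepresentation V) :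
    InfinitesimallyFormBounded V := by
  obtain ⟨Γ, γ, hb, rfl⟩ := h
  intro ε hε
  obtain ⟨M, hM0, hM⟩ := hb.lintegral_le
  set w : ℝ → ℝ≥0∞ := fun t => ENNReal.ofReal (2 / ε) * ‖Γ t‖ₑ ^ 2 + ‖γ t‖ₑ with hwdef
  have hwm : AEMeasurable w := ((hb.1.enorm.pow_const 2).const_mul _).add hb.2.1.enorm
  set M' : ℝ := (2 / ε + 1) * M with hM'
  have hM'0 : 0 ≤ M' := by positivity
  have hwM : ∀ x, ∫⁻ t in Set.Icc x (x + 1), w t ≤ ENNReal.ofReal M' := fun x => by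
    calc ∫⁻ t in Set.Icc x (x + 1), w t
        ≤ ∫⁻ t in Set.Icc x (x + 1), ENNReal.ofReal (2 / ε + 1) * (‖Γ t‖ₑ ^ 2 + ‖γ t‖ₑ) := by
          refine lintegral_mono fun t => ?_
          rw [mul_add]
          refine add_le_add (mul_le_mul_left (ENNReal.ofReal_le_ofReal (by linarith)) _) ?_
          refine le_mul_of_one_le_left (zero_le) ?_
          rw [← ENNReal.ofReal_one]
          exact ENNReal.ofReal_le_ofReal (by linarith [div_pos two_pos hε])
      _ = ENNReal.ofReal (2 / ε + 1) * ∫⁻ t in Set.Icc x (x + 1), (‖Γ t‖ₑ ^ 2 + ‖γ t‖ₑ) :=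
          lintegral_const_mul' _ _ ENNReal.ofReal_ne_top
      _ ≤ ENNReal.ofReal M' := by
          rw [hM', ENNReal.ofReal_mul (by positivity)]
          gcongr
          exact hM x
  -- Chosen so that `M' ε' ≤ ε / 2`; the other half of `ε` is spent on `|Γ u u'|`.
  set ε' : ℝ := ε / (2 * (M' + 1)) with hε'
  have hε'0 : 0 < ε' := by positivity
  refine ⟨M' * (1 + 1 / ε') + 1, by positivity, fun u => ?_⟩
  have hsq : ∀ t, ‖((deriv (absSq u) t : ℝ) : ℂ) * Γ t‖ₑ + ‖((absSq u t : ℝ) : ℂ) * γ t‖ₑ ≤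
      ENNReal.ofReal (ε / 2 * ‖deriv u t‖ ^ 2) + ENNReal.ofReal (‖u t‖ ^ 2) * w t := fun t => by
    have e1 : ‖((absSq u t : ℝ) : ℂ) * γ t‖ₑ = ENNReal.ofReal (‖u t‖ ^ 2) * ‖γ t‖ₑ := by
      rw [enorm_mul, ← ofReal_norm ((absSq u t : ℝ) : ℂ), Complex.norm_real, absSq_apply,
        Real.norm_of_nonneg (by positivity)]
    have e2 : ‖((deriv (absSq u) t : ℝ) : ℂ) * Γ t‖ₑ ≤ ENNReal.ofReal (ε / 2 * ‖deriv u t‖ ^ 2) +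
        ENNReal.ofReal (‖u t‖ ^ 2) * (ENNReal.ofReal (2 / ε) * ‖Γ t‖ₑ ^ 2) := by
      rw [← ofReal_norm, ← ofReal_norm, ← ENNReal.ofReal_pow (norm_nonneg _),
        ← ENNReal.ofReal_mul (by positivity), ← ENNReal.ofReal_mul (by positivity),
        ← ENNReal.ofReal_add (by positivity) (by positivity)]
      refine ENNReal.ofReal_le_ofReal ?_
      rw [norm_mul, Complex.norm_real, Real.norm_eq_abs]
      refine (mul_le_mul_of_nonneg_right (abs_deriv_absSq_le u t) (norm_nonneg _)).trans ?_
      have h3 : ε / 2 * ‖deriv u t‖ ^ 2 + ‖u t‖ ^ 2 * (2 / ε * ‖Γ t‖ ^ 2)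
          - 2 * (‖u t‖ * ‖deriv u t‖) * ‖Γ t‖
          = 1 / (2 * ε) * (ε * ‖deriv u t‖ - 2 * (‖u t‖ * ‖Γ t‖)) ^ 2 := by field_simp; ring
      have h4 : 0 ≤ 1 / (2 * ε) * (ε * ‖deriv u t‖ - 2 * (‖u t‖ * ‖Γ t‖)) ^ 2 := by positivity
      linarith
    rw [hwdef, e1, mul_add, ← add_assoc]
    gcongr
  have hmain : ‖quadForm (∂_{(1 : ℝ)} (ofFun Γ) + ofFun γ) u‖ₑ ≤
      ENNReal.ofReal (ε / 2 * derivSq u + M' * (ε' * derivSq u + (1 + 1 / ε') * l2Sq u)) := by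
    rw [quadForm, representation_apply hb]
    calc _ ≤ (∫⁻ t, ‖((deriv (absSq u) t : ℝ) : ℂ) * Γ t‖ₑ) +
          ∫⁻ t, ‖((absSq u t : ℝ) : ℂ) * γ t‖ₑ := by
          refine (enorm_add_le _ _).trans ?_
          rw [enorm_neg]
          exact add_le_add (enorm_integral_le_lintegral_enorm _)
            (enorm_integral_le_lintegral_enorm _)
      _ = ∫⁻ t, (‖((deriv (absSq u) t : ℝ) : ℂ) * Γ t‖ₑ + ‖((absSq u t : ℝ) : ℂ) * γ t‖ₑ) := by
          refine (lintegral_add_left' ?_ _).symm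
          exact ((Complex.continuous_ofReal.comp
            (continuous_deriv_test (absSq u))).aestronglyMeasurable.mul hb.1).enorm
      _ ≤ ∫⁻ t, (ENNReal.ofReal (ε / 2 * ‖deriv u t‖ ^ 2) + ENNReal.ofReal (‖u t‖ ^ 2) * w t) :=
          lintegral_mono hsq
      _ = (∫⁻ t, ENNReal.ofReal (ε / 2 * ‖deriv u t‖ ^ 2)) +
            ∫⁻ t, ENNReal.ofReal (‖u t‖ ^ 2) * w t := by
          refine lintegral_add_left ?_ _
          exact ENNReal.measurable_ofReal.comp
            (((continuous_deriv_test u).norm.pow 2).const_mul (ε / 2)).measurable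
      _ ≤ _ := by
          have hD := derivSq_nonneg u
          have hL := l2Sq_nonneg u
          rw [ENNReal.ofReal_add (by positivity) (by positivity)]
          refine add_le_add (le_of_eq ?_) (lintegral_weight_mul_sq_le hM'0 hwm hwM u hε'0)
          rw [← ofReal_integral_eq_lintegral_ofReal ((integrable_sq_norm_deriv u).const_mul _)
            (ae_of_all _ fun t => by positivity), integral_const_mul]
          rfl
  have hD := derivSq_nonneg u
  have hL := l2Sq_nonneg u
  rw [← ofReal_norm, ENNReal.ofReal_le_ofReal_iff (by positivity)] at hmain
  have hMε : M' * ε' ≤ ε / 2 := by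
    rw [hε', ← sub_nonneg]
    have : ε / 2 - M' * (ε / (2 * (M' + 1))) = ε / (2 * (M' + 1)) := by field_simp; ring
    rw [this]; positivity
  nlinarith [mul_le_mul_of_nonneg_right hMε hD]

theorem InfinitesimallyFormBounded.isFormBounded {V : Distr} (h : InfinitesimallyFormBounded V) :
    IsFormBounded V := by
  obtain ⟨C, -, hC⟩ := h 1 one_pos
  refine ⟨max 1 C, fun u => (hC u).trans ?_⟩
  rw [sobolevNorm_sq, mul_add]
  exact add_le_add (mul_le_mul_of_nonneg_right (le_max_left _ _) (derivSq_nonneg u))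
    (mul_le_mul_of_nonneg_right (le_max_right _ _) (l2Sq_nonneg u))

/-! ### From form boundedness to the uniform dual norm -/

/-- The test function `y ↦ conj (η (x - y))`. -/
noncomputable def conjReflect (η : CTest) (x : ℝ) : CTest :=
  testOf (fun y => (starRingEnd ℂ) (η (x - y)))
    (Complex.conjCLE.contDiff.comp (η.contDiff.comp (contDiff_const.sub contDiff_id)))
    ((η.hasCompactSupport.comp_homeomorph (Homeomorph.subLeft x)).comp_left (map_zero _))

theorem conjReflect_apply (η : CTest) (x y : ℝ) :
    conjReflect η x y = (starRingEnd ℂ) (η (x - y)) := rfl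

theorem deriv_conjReflect (η : CTest) (x y : ℝ) :
    deriv (conjReflect η x) y = -(starRingEnd ℂ) (deriv η (x - y)) := by
  have h1 : HasDerivAt (fun y => η (x - y)) (-deriv η (x - y)) y := by
    simpa using (differentiable_test η (x - y)).hasDerivAt.comp_const_sub x y
  have h2 := (Complex.conjCLE : ℂ →L[ℝ] ℂ).hasFDerivAt.comp_hasDerivAt y h1
  exact h2.deriv.trans (by simp)

theorem l2Sq_conjReflect (η : CTest) (x : ℝ) : l2Sq (conjReflect η x) = l2Sq η := by
  unfold l2Sq
  simp_rw [conjReflect_apply, RCLike.norm_conj]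
  exact integral_sub_left_eq_self (fun y => ‖η y‖ ^ 2) volume x

theorem derivSq_conjReflect (η : CTest) (x : ℝ) : derivSq (conjReflect η x) = derivSq η := by
  unfold derivSq
  simp_rw [deriv_conjReflect, norm_neg, RCLike.norm_conj]
  exact integral_sub_left_eq_self (fun y => ‖deriv η y‖ ^ 2) volume x

theorem sq_norm_add_smul_le {c : ℂ} (hc : ‖c‖ = 1) (a b : ℂ) :
    ‖a + c * b‖ ^ 2 ≤ 2 * ‖a‖ ^ 2 + 2 * ‖b‖ ^ 2 := by
  have h : ‖a + c * b‖ ≤ ‖a‖ + ‖b‖ := (norm_add_le _ _).trans (by rw [norm_mul, hc, one_mul])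
  nlinarith [norm_nonneg (a + c * b), sq_nonneg (‖a‖ - ‖b‖)]

theorem sq_sobolevNorm_add_smul_le {c : ℂ} (hc : ‖c‖ = 1) (u v : CTest) :
    sobolevNorm (u + c • v) ^ 2 ≤ 2 * sobolevNorm u ^ 2 + 2 * sobolevNorm v ^ 2 := by
  have h1 : l2Sq (u + c • v) ≤ 2 * l2Sq u + 2 * l2Sq v := by
    unfold l2Sq
    rw [← integral_const_mul, ← integral_const_mul, ← integral_add
      ((integrable_sq_norm u).const_mul 2) ((integrable_sq_norm v).const_mul 2)]
    exact integral_mono (integrable_sq_norm _)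
      (((integrable_sq_norm u).const_mul 2).add ((integrable_sq_norm v).const_mul 2))
      fun x => sq_norm_add_smul_le hc (u x) (v x)
  have h2 : derivSq (u + c • v) ≤ 2 * derivSq u + 2 * derivSq v := by
    unfold derivSq
    rw [← integral_const_mul, ← integral_const_mul, ← integral_add
      ((integrable_sq_norm_deriv u).const_mul 2) ((integrable_sq_norm_deriv v).const_mul 2)]
    refine integral_mono (integrable_sq_norm_deriv _)
      (((integrable_sq_norm_deriv u).const_mul 2).add ((integrable_sq_norm_deriv v).const_mul 2))
      fun x => ?_
    have : deriv (u + c • v : CTest) x = deriv u x + c * deriv v x :=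
      ((differentiable_test u x).hasDerivAt.add
        ((differentiable_test v x).hasDerivAt.const_mul c)).deriv
    change ‖deriv (u + c • v : CTest) x‖ ^ 2 ≤ _
    rw [this]
    exact sq_norm_add_smul_le hc _ _
  rw [sobolevNorm_sq, sobolevNorm_sq, sobolevNorm_sq]
  linarith

/-- Polarization: the pairing with `η(x - ·) φ` in terms of the quadratic form. -/
theorem pairing_translateMul_eq (V : Distr) (η : CTest) (x : ℝ) (φ : CTest) :
    pairing V (translateMul η x φ) = (1 / 4 : ℝ) •
      ((quadForm V (φ + (1 : ℂ) • conjReflect η x) - quadForm V (φ + (-1 : ℂ) • conjReflect η x)) +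
        Complex.I * (quadForm V (φ + Complex.I • conjReflect η x) -
          quadForm V (φ + (-Complex.I) • conjReflect η x))) := by
  have key : ∀ a b : ℂ, ‖a + b‖ ^ 2 = ‖a‖ ^ 2 + ‖b‖ ^ 2 + 2 * (a * (starRingEnd ℂ) b).re := by
    intro a b
    rw [← Complex.normSq_eq_norm_sq, ← Complex.normSq_eq_norm_sq, ← Complex.normSq_eq_norm_sq,
      Complex.normSq_add]
  have hre : TestFunction.postcompCLM Complex.reCLM (translateMul η x φ) = (1 / 4 : ℝ) •
      (absSq (φ + (1 : ℂ) • conjReflect η x) - absSq (φ + (-1 : ℂ) • conjReflect η x)) := by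
    ext y
    change (η (x - y) * φ y).re = (1 / 4 : ℝ) * (‖φ y + 1 * (starRingEnd ℂ) (η (x - y))‖ ^ 2 -
      ‖φ y + -1 * (starRingEnd ℂ) (η (x - y))‖ ^ 2)
    rw [key, key]
    simp
    ring
  have him : TestFunction.postcompCLM Complex.imCLM (translateMul η x φ) = (1 / 4 : ℝ) •
      (absSq (φ + Complex.I • conjReflect η x) - absSq (φ + (-Complex.I) • conjReflect η x)) := by
    ext y
    change (η (x - y) * φ y).im = (1 / 4 : ℝ) *
      (‖φ y + Complex.I * (starRingEnd ℂ) (η (x - y))‖ ^ 2 -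
      ‖φ y + -Complex.I * (starRingEnd ℂ) (η (x - y))‖ ^ 2)
    rw [key, key]
    simp
    ring
  rw [pairing, hre, him]
  simp only [map_smul, map_sub, quadForm, Complex.real_smul]
  ring

theorem IsFormBounded.memUnif {V : Distr} (h : IsFormBounded V) (η : CTest) : MemUnif η V := by
  obtain ⟨C, hC⟩ := h
  refine (iSup_le fun x => iSup₂_le fun φ hφ => ?_ :
    unifNorm η V ≤ ENNReal.ofReal (|C| * (2 + 2 * sobolevNorm η ^ 2))).trans_lt
      ENNReal.ofReal_lt_top
  rw [← ofReal_norm]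
  refine ENNReal.ofReal_le_ofReal ?_
  have hφ2 : sobolevNorm φ ^ 2 ≤ 1 := by
    have : 0 ≤ sobolevNorm φ := Real.sqrt_nonneg _
    exact pow_le_one₀ this hφ
  have hη : sobolevNorm (conjReflect η x) ^ 2 = sobolevNorm η ^ 2 := by
    rw [sobolevNorm_sq, sobolevNorm_sq, l2Sq_conjReflect, derivSq_conjReflect]
  have hb : ∀ c : ℂ, ‖c‖ = 1 → ‖quadForm V (φ + c • conjReflect η x)‖ ≤
      |C| * (2 + 2 * sobolevNorm η ^ 2) := fun c hc => by
    refine (hC _).trans ((mul_le_mul_of_nonneg_right (le_abs_self C) (sq_nonneg _)).trans ?_)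
    refine mul_le_mul_of_nonneg_left ?_ (abs_nonneg C)
    refine (sq_sobolevNorm_add_smul_le hc _ _).trans ?_
    rw [hη]
    linarith
  change ‖pairing V (translateMul η x φ)‖ ≤ _
  rw [pairing_translateMul_eq, norm_smul, Real.norm_of_nonneg (by norm_num)]
  have h1 := hb 1 (by simp)
  have h2 := hb (-1) (by simp)
  have h3 := hb Complex.I (by simp)
  have h4 := hb (-Complex.I) (by simp)
  have h5 : ‖Complex.I * (quadForm V (φ + Complex.I • conjReflect η x) -
      quadForm V (φ + (-Complex.I) • conjReflect η x))‖ ≤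
        2 * (|C| * (2 + 2 * sobolevNorm η ^ 2)) := by
    rw [norm_mul, Complex.norm_I, one_mul]
    exact (norm_sub_le _ _).trans (by linarith)
  have h6 := norm_sub_le (quadForm V (φ + (1 : ℂ) • conjReflect η x))
    (quadForm V (φ + (-1 : ℂ) • conjReflect η x))
  have h7 := norm_add_le (quadForm V (φ + (1 : ℂ) • conjReflect η x) -
    quadForm V (φ + (-1 : ℂ) • conjReflect η x)) (Complex.I * (quadForm V
      (φ + Complex.I • conjReflect η x) - quadForm V (φ + (-Complex.I) • conjReflect η x)))
  linarith

/-! ### Functionals on the Sobolev space -/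

section TestFunctions

variable {F : Type*} [NormedAddCommGroup F] [NormedSpace ℝ F]

theorem memLp_test (u : 𝓓((⊤ : Opens ℝ), F)) : MemLp u 2 (volume : Measure ℝ) :=
  u.continuous.memLp_of_hasCompactSupport u.hasCompactSupport

theorem memLp_deriv_test (u : 𝓓((⊤ : Opens ℝ), F)) : MemLp (deriv u) 2 (volume : Measure ℝ) :=
  (continuous_deriv_test u).memLp_of_hasCompactSupport u.hasCompactSupport.deriv

end TestFunctions

/-- The Hilbert space `L₂(ℝ) × L₂(ℝ)`. -/
abbrev L2Pair : Type := WithLp 2 (Lp ℂ 2 (volume : Measure ℝ) × Lp ℂ 2 (volume : Measure ℝ))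

/-- The map `u ↦ (u, u')`, which embeds `W^1_2(ℝ)` isometrically into `L₂(ℝ) × L₂(ℝ)`. -/
noncomputable def sobolevEmb : CTest →ₗ[ℂ] L2Pair where
  toFun u := WithLp.toLp 2 ((memLp_test u).toLp u, (memLp_deriv_test u).toLp (deriv u))
  map_add' u v := by
    rw [← WithLp.toLp_add, Prod.mk_add_mk, ← MemLp.toLp_add, ← MemLp.toLp_add]
    congr 2
    refine MemLp.toLp_congr _ _ (ae_of_all _ fun x => ?_)
    exact ((differentiable_test u x).hasDerivAt.add (differentiable_test v x).hasDerivAt).deriv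
  map_smul' c u := by
    rw [RingHom.id_apply, ← WithLp.toLp_smul, Prod.smul_mk, ← MemLp.toLp_const_smul,
      ← MemLp.toLp_const_smul]
    congr 2
    refine MemLp.toLp_congr _ _ (ae_of_all _ fun x => ?_)
    exact ((differentiable_test u x).hasDerivAt.const_smul c).deriv

theorem sq_norm_toLp {f : ℝ → ℂ} (hf : MemLp f 2 (volume : Measure ℝ)) :
    ‖hf.toLp f‖ ^ 2 = ∫ x, ‖f x‖ ^ 2 := by
  have h := @inner_self_eq_norm_sq_to_K ℂ _ _ _ _ (hf.toLp f)
  rw [L2.inner_def] at h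
  have h2 : ∫ a, inner ℂ (hf.toLp f a) (hf.toLp f a) = ((∫ x, ‖f x‖ ^ 2 : ℝ) : ℂ) := by
    rw [← integral_complex_ofReal]
    refine integral_congr_ae ?_
    filter_upwards [hf.coeFn_toLp] with a ha
    rw [ha, inner_self_eq_norm_sq_to_K]
    simp
  rw [h2] at h
  exact Complex.ofReal_injective (by rw [h]; push_cast; rfl)

theorem norm_sobolevEmb (u : CTest) : ‖sobolevEmb u‖ = sobolevNorm u := by
  rw [WithLp.prod_norm_eq_of_L2, sobolevNorm, add_comm]
  congr 2
  · exact sq_norm_toLp (memLp_deriv_test u)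
  · exact sq_norm_toLp (memLp_test u)

theorem lintegral_sq_enorm_Lp (f : Lp ℂ 2 (volume : Measure ℝ)) :
    ∫⁻ t, ‖f t‖ₑ ^ 2 = ENNReal.ofReal (‖f‖ ^ 2) := by
  have h := eLpNorm_nnreal_pow_eq_lintegral (f := f) (μ := volume) (p := 2) (by norm_num)
  simp only [NNReal.coe_ofNat, ENNReal.coe_ofNat, ENNReal.rpow_ofNat] at h
  rw [← h, ← Lp.enorm_def, ENNReal.ofReal_pow (norm_nonneg _), ofReal_norm]

/-- Riesz representation for `W^{-1}_2(ℝ)`: a functional on test functions that is bounded in the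
Sobolev norm is `g - h'` for some `g, h ∈ L₂(ℝ)`. -/
theorem exists_l2_representation (L : CTest →ₗ[ℂ] ℂ) {M : ℝ}
    (hL : ∀ u, ‖L u‖ ≤ M * sobolevNorm u) (hM : 0 ≤ M) :
    ∃ g h : ℝ → ℂ, MemLp g 2 (volume : Measure ℝ) ∧ MemLp h 2 (volume : Measure ℝ) ∧
      ∫⁻ t, ‖g t‖ₑ ^ 2 ≤ ENNReal.ofReal (M ^ 2) ∧ ∫⁻ t, ‖h t‖ₑ ^ 2 ≤ ENNReal.ofReal (M ^ 2) ∧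
      ∀ u : CTest, L u = ∫ t, (u t * g t + deriv u t * h t) := by
  -- The image of the test functions is not dense in `L₂ × L₂`, so the functional is extended to
  -- the closure of the image only.
  set S : Submodule ℂ L2Pair := (LinearMap.range sobolevEmb).topologicalClosure with hS
  have : CompleteSpace S :=
    (Submodule.isClosed_topologicalClosure (LinearMap.range sobolevEmb)).completeSpace_coe
  set E : CTest →ₗ[ℂ] S := sobolevEmb.codRestrict S fun u =>
    Submodule.le_topologicalClosure _ (LinearMap.mem_range_self _ u) with hE
  have hdense : DenseRange E := by
    intro x
    rw [closure_subtype]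
    have : ((↑) : S → L2Pair) '' Set.range E = LinearMap.range sobolevEmb := by
      rw [← Set.range_comp]; rfl
    rw [this]
    exact x.2
  have hnorm : ∀ u, ‖L u‖ ≤ M * ‖E u‖ := fun u => by
    have : ‖E u‖ = sobolevNorm u := norm_sobolevEmb u
    rw [this]; exact hL u
  set f : S →L[ℂ] ℂ := L.extendOfNorm E with hf
  set v : S := (InnerProductSpace.toDual ℂ S).symm f with hv
  have hvM : ‖v‖ ≤ M := by
    rw [hv, LinearIsometryEquiv.norm_map]
    exact LinearMap.opNorm_extendOfNorm_le hdense hM hnorm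
  have hvM' : ‖(v : L2Pair)‖ ^ 2 ≤ M ^ 2 := pow_le_pow_left₀ (norm_nonneg _) hvM 2
  rw [WithLp.prod_norm_sq_eq_of_L2] at hvM'
  have hconj : ∀ w : Lp ℂ 2 (volume : Measure ℝ), MemLp (fun t => (starRingEnd ℂ) (w t)) 2 volume :=
    fun w => (Lp.memLp w).star
  refine ⟨fun t => (starRingEnd ℂ) ((v : L2Pair).fst t), fun t => (starRingEnd ℂ)
    ((v : L2Pair).snd t), hconj _, hconj _, ?_, ?_, fun u => ?_⟩
  · simp_rw [RCLike.enorm_conj]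
    rw [lintegral_sq_enorm_Lp]
    exact ENNReal.ofReal_le_ofReal (by nlinarith [sq_nonneg ‖(v : L2Pair).snd‖])
  · simp_rw [RCLike.enorm_conj]
    rw [lintegral_sq_enorm_Lp]
    exact ENNReal.ofReal_le_ofReal (by nlinarith [sq_nonneg ‖(v : L2Pair).fst‖])
  · have h1 : L u = inner ℂ v (E u) := by
      rw [hv, InnerProductSpace.toDual_symm_apply, hf,
        LinearMap.extendOfNorm_eq hdense ⟨M, hnorm⟩]
    rw [h1, Submodule.coe_inner, WithLp.prod_inner_apply, L2.inner_def, L2.inner_def,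
      ← integral_add (L2.integrable_inner _ _) (L2.integrable_inner _ _)]
    refine integral_congr_ae ?_
    have e1 : ∀ᵐ t, (E u : L2Pair).fst t = u t := (memLp_test u).coeFn_toLp
    have e2 : ∀ᵐ t, (E u : L2Pair).snd t = deriv u t := (memLp_deriv_test u).coeFn_toLp
    filter_upwards [e1, e2] with t h1 h2
    have h1' : (WithLp.ofLp (E u : L2Pair)).1 t = u t := h1
    have h2' : (WithLp.ofLp (E u : L2Pair)).2 t = deriv u t := h2
    rw [h1', h2', RCLike.inner_apply, RCLike.inner_apply]
    rfl

/-! ### Localization of a distribution in the uniform dual space -/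

/-- The functional `φ ↦ ⟨η(x - ·) V, φ⟩`. -/
noncomputable def localized (V : Distr) (η : CTest) (x : ℝ) : CTest →ₗ[ℂ] ℂ where
  toFun φ := pairing V (translateMul η x φ)
  map_add' φ ψ := by
    have h : translateMul η x (φ + ψ) = translateMul η x φ + translateMul η x ψ := by
      ext y; exact mul_add _ _ _
    simp only [pairing, h, map_add]
    ring
  map_smul' c φ := by
    have h1 : TestFunction.postcompCLM Complex.reCLM (translateMul η x (c • φ)) =
        c.re • TestFunction.postcompCLM Complex.reCLM (translateMul η x φ) -
          c.im • TestFunction.postcompCLM Complex.imCLM (translateMul η x φ) := by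
      ext y
      change (η (x - y) * (c * φ y)).re = c.re * (η (x - y) * φ y).re - c.im * (η (x - y) * φ y).im
      rw [mul_left_comm, Complex.mul_re]
    have h2 : TestFunction.postcompCLM Complex.imCLM (translateMul η x (c • φ)) =
        c.re • TestFunction.postcompCLM Complex.imCLM (translateMul η x φ) +
          c.im • TestFunction.postcompCLM Complex.reCLM (translateMul η x φ) := by
      ext y
      change (η (x - y) * (c * φ y)).im = c.re * (η (x - y) * φ y).im + c.im * (η (x - y) * φ y).re
      rw [mul_left_comm, Complex.mul_im]
    simp only [pairing, h1, h2, map_add, map_sub, map_smul, Complex.real_smul, RingHom.id_apply,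
      smul_eq_mul]
    conv_rhs => rw [← Complex.re_add_im c]
    linear_combination (-(c.im : ℂ) * V (TestFunction.postcompCLM Complex.imCLM
      (translateMul η x φ))) * Complex.I_sq

theorem sobolevNorm_smul (c : ℂ) (u : CTest) : sobolevNorm (c • u) = ‖c‖ * sobolevNorm u := by
  rw [← norm_sobolevEmb, map_smul, norm_smul, norm_sobolevEmb]

theorem MemUnif.exists_bound {V : Distr} {η : CTest} (h : MemUnif η V) :
    ∃ M : ℝ, 0 ≤ M ∧ ∀ x u, ‖localized V η x u‖ ≤ M * sobolevNorm u := by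
  have key : ∀ x u, sobolevNorm u ≤ 1 → ‖localized V η x u‖ ≤ (unifNorm η V).toReal := by
    intro x u hu
    rw [← ENNReal.ofReal_le_ofReal_iff ENNReal.toReal_nonneg, ofReal_norm,
      ENNReal.ofReal_toReal h.ne]
    refine le_trans ?_ (le_iSup (fun x : ℝ =>
      dualSobolevNorm (fun φ => pairing V (translateMul η x φ))) x)
    exact le_iSup₂ (f := fun (φ : CTest) (_ : sobolevNorm φ ≤ 1) =>
      ‖pairing V (translateMul η x φ)‖ₑ) u hu
  refine ⟨(unifNorm η V).toReal, ENNReal.toReal_nonneg, fun x u => ?_⟩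
  have hs0 : 0 ≤ sobolevNorm u := Real.sqrt_nonneg _
  -- The scale `s` lies above the norm, which may vanish a priori.
  have hs : ∀ s, sobolevNorm u < s → ‖localized V η x u‖ ≤ (unifNorm η V).toReal * s := by
    intro s hs
    have hspos : 0 < s := hs0.trans_lt hs
    have hn : ‖((s⁻¹ : ℝ) : ℂ)‖ = s⁻¹ := by
      rw [Complex.norm_real, Real.norm_of_nonneg (inv_nonneg.2 hspos.le)]
    have h1 := key x (((s⁻¹ : ℝ) : ℂ) • u) (by
      rw [sobolevNorm_smul, hn, inv_mul_le_iff₀ hspos]; linarith)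
    rw [map_smul, norm_smul, hn, inv_mul_le_iff₀ hspos] at h1
    linarith
  have hlim : Tendsto (fun s => (unifNorm η V).toReal * s) (𝓝[>] (sobolevNorm u))
      (𝓝 ((unifNorm η V).toReal * sobolevNorm u)) :=
    (tendsto_id.const_mul _).mono_left nhdsWithin_le_nhds
  exact ge_of_tendsto hlim (eventually_nhdsWithin_of_forall hs)

/-! ### Gluing locally finite families of square integrable functions -/

section Gluing

variable {N : ℕ} {a : ℤ → ℝ → ℂ}

/-- The indices of the members of the family that can be nonzero on `[x, x + 1]`. -/
noncomputable def nearIndices (N : ℕ) (x : ℝ) : Finset ℤ :=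
  Finset.Icc (⌊N * x⌋ - 1) (⌊N * x⌋ + N + 2)

theorem card_nearIndices (N : ℕ) (x : ℝ) : (nearIndices N x).card = N + 4 := by
  rw [nearIndices, Int.card_Icc]
  omega

theorem mem_nearIndices {x t : ℝ} (ht : t ∈ Set.Icc x (x + 1)) {k : ℤ} (hk : |k - N * t| ≤ 1) :
    k ∈ nearIndices N x := by
  rw [abs_le] at hk
  have hN : (0 : ℝ) ≤ N := Nat.cast_nonneg N
  have h1 : (N : ℝ) * x ≤ N * t := mul_le_mul_of_nonneg_left ht.1 hN
  have h2 : (N : ℝ) * t ≤ N * x + N := by nlinarith [mul_le_mul_of_nonneg_left ht.2 hN]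
  have h3 := Int.floor_le ((N : ℝ) * x)
  have h4 := Int.lt_floor_add_one ((N : ℝ) * x)
  rw [nearIndices, Finset.mem_Icc]
  constructor
  · have : ((⌊N * x⌋ - 1 : ℤ) : ℝ) ≤ k := by push_cast; linarith
    exact_mod_cast this
  · have : (k : ℝ) ≤ ((⌊N * x⌋ + N + 2 : ℤ) : ℝ) := by push_cast; linarith
    exact_mod_cast this

theorem tsum_eq_sum_nearIndices (hsupp : ∀ (k : ℤ) (t : ℝ), 1 < |(k : ℝ) - N * t| → a k t = 0)
    {x t : ℝ} (ht : t ∈ Set.Icc x (x + 1)) : ∑' k, a k t = ∑ k ∈ nearIndices N x, a k t :=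
  tsum_eq_sum fun k hk => hsupp k t (not_le.1 fun h => hk (mem_nearIndices ht h))

theorem aestronglyMeasurable_tsum (ha : ∀ k, AEStronglyMeasurable (a k) volume)
    (hsupp : ∀ (k : ℤ) (t : ℝ), 1 < |(k : ℝ) - N * t| → a k t = 0) :
    AEStronglyMeasurable (fun t => ∑' k, a k t) volume := by
  rw [← Measure.restrict_univ (μ := (volume : Measure ℝ)), ← iUnion_Icc_intCast ℝ,
    aestronglyMeasurable_iUnion_iff]
  intro n
  have h : AEStronglyMeasurable (fun t => ∑ k ∈ nearIndices N n, a k t) volume :=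
    Finset.aestronglyMeasurable_fun_sum _ fun k _ => ha k
  refine h.restrict.congr ?_
  filter_upwards [ae_restrict_mem measurableSet_Icc] with t ht
  exact (tsum_eq_sum_nearIndices hsupp ht).symm

/-- At most `N + 4` members of the family are nonzero on `[x, x + 1]` (Cauchy–Schwarz). -/
theorem lintegral_sq_tsum_le (ha : ∀ k, AEStronglyMeasurable (a k) volume) {A : ℝ≥0∞}
    (hA : ∀ k, ∫⁻ t, ‖a k t‖ₑ ^ 2 ≤ A)
    (hsupp : ∀ (k : ℤ) (t : ℝ), 1 < |(k : ℝ) - N * t| → a k t = 0) (x : ℝ) :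
    ∫⁻ t in Set.Icc x (x + 1), ‖∑' k, a k t‖ₑ ^ 2 ≤ ((N + 4 : ℕ) : ℝ≥0∞) ^ 2 * A := by
  have hcs : ∀ t, ‖∑ k ∈ nearIndices N x, a k t‖ₑ ^ 2 ≤
      ((N + 4 : ℕ) : ℝ≥0∞) * ∑ k ∈ nearIndices N x, ‖a k t‖ₑ ^ 2 := fun t => by
    have h := ENNReal.rpow_sum_le_const_mul_sum_rpow (nearIndices N x) (fun k => ‖a k t‖ₑ)
      (p := 2) (by norm_num)
    rw [card_nearIndices, show (2 : ℝ) - 1 = 1 by norm_num, ENNReal.rpow_one] at h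
    simp only [ENNReal.rpow_ofNat] at h
    refine le_trans ?_ h
    gcongr
    exact enorm_sum_le _ _
  calc ∫⁻ t in Set.Icc x (x + 1), ‖∑' k, a k t‖ₑ ^ 2
      = ∫⁻ t in Set.Icc x (x + 1), ‖∑ k ∈ nearIndices N x, a k t‖ₑ ^ 2 :=
        setLIntegral_congr_fun measurableSet_Icc fun t ht => by
          simp only [tsum_eq_sum_nearIndices hsupp ht]
    _ ≤ ∫⁻ t, ((N + 4 : ℕ) : ℝ≥0∞) * ∑ k ∈ nearIndices N x, ‖a k t‖ₑ ^ 2 :=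
        (setLIntegral_le_lintegral _ _).trans (lintegral_mono hcs)
    _ = ((N + 4 : ℕ) : ℝ≥0∞) * ∑ k ∈ nearIndices N x, ∫⁻ t, ‖a k t‖ₑ ^ 2 := by
        rw [lintegral_const_mul' _ _ (ENNReal.natCast_ne_top _),
          lintegral_finsetSum' _ fun k _ => (ha k).enorm.pow_const 2]
    _ ≤ ((N + 4 : ℕ) : ℝ≥0∞) * ∑ k ∈ nearIndices N x, A := by
        gcongr with k
        exact hA k
    _ = ((N + 4 : ℕ) : ℝ≥0∞) ^ 2 * A := by
        rw [Finset.sum_const, card_nearIndices, nsmul_eq_mul, sq, mul_assoc]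

/-- If `φ` vanishes outside `[-m, m]`, only the indices up to `N m + 2` matter. -/
theorem integral_mul_tsum (ha : ∀ k, MemLp (a k) 2 volume)
    (hsupp : ∀ (k : ℤ) (t : ℝ), 1 < |(k : ℝ) - N * t| → a k t = 0) {φ : ℝ → ℂ}
    (hφ : MemLp φ 2 volume) {m : ℕ}
    (hm : ∀ t, (m : ℝ) < |t| → φ t = 0) :
    ∫ t, φ t * ∑' k, a k t =
      ∑ k ∈ Finset.Ico (-((N * m + 2 : ℕ) : ℤ)) (N * m + 2 : ℕ), ∫ t, φ t * a k t := by
  have hint : ∀ k, Integrable fun t => φ t * a k t := fun k => hφ.integrable_mul (ha k)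
  have hpt : ∀ t, φ t * ∑' k, a k t =
      ∑ k ∈ Finset.Ico (-((N * m + 2 : ℕ) : ℤ)) (N * m + 2 : ℕ), φ t * a k t := by
    intro t
    by_cases ht : (m : ℝ) < |t|
    · simp [hm t ht]
    · rw [← Finset.mul_sum]
      congr 1
      refine tsum_eq_sum fun k hk => hsupp k t (not_le.1 fun h => hk ?_)
      have h1 : (N : ℝ) * |t| ≤ N * m := mul_le_mul_of_nonneg_left (not_lt.1 ht) (Nat.cast_nonneg N)
      have h2 : |(k : ℝ)| ≤ N * m + 1 := by
        have h3 : |(N : ℝ) * t| = N * |t| := by rw [abs_mul, Nat.abs_cast]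
        have h4 := abs_add_le ((k : ℝ) - N * t) (N * t)
        rw [sub_add_cancel, h3] at h4
        linarith
      have h5 : |k| ≤ ((N * m + 1 : ℕ) : ℤ) := by
        have : ((|k| : ℤ) : ℝ) ≤ (((N * m + 1 : ℕ) : ℤ) : ℝ) := by push_cast; exact h2
        exact_mod_cast this
      rw [abs_le] at h5
      rw [Finset.mem_Ico]
      push_cast at h5 ⊢
      constructor <;> linarith [h5.1, h5.2]
  simp_rw [hpt]
  exact integral_finsetSum _ fun k _ => hint k

end Gluing

/-! ### A partition of unity subordinate to translates of `η` -/

/-- The bump `s ↦ σ(N s + 1) - σ(N s)`, for the smooth step `σ`. It is supported in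
`[-1/N, 1/N]`, and its translates by multiples of `1/N` add up to `1` by telescoping. -/
noncomputable def stepBump (N : ℕ) (s : ℝ) : ℝ :=
  Real.smoothTransition (N * s + 1) - Real.smoothTransition (N * s)

theorem contDiff_stepBump (N : ℕ) : ContDiff ℝ ((⊤ : ℕ∞) : WithTop ℕ∞) (stepBump N) :=
  (Real.smoothTransition.contDiff.comp ((contDiff_const.mul contDiff_id).add contDiff_const)).sub
    (Real.smoothTransition.contDiff.comp (contDiff_const.mul contDiff_id))

theorem stepBump_eq_zero {N : ℕ} {s : ℝ} (h : 1 ≤ |N * s|) : stepBump N s = 0 := by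
  rw [stepBump]
  rcases le_abs.1 h with h | h
  · rw [Real.smoothTransition.one_of_one_le (by linarith), Real.smoothTransition.one_of_one_le h,
      sub_self]
  · rw [Real.smoothTransition.zero_of_nonpos (by linarith),
      Real.smoothTransition.zero_of_nonpos (by linarith), sub_self]

/-- The translates of `stepBump` by multiples of `1 / N` add up to `1`. On `[-m, m]` only the
indices `|k| ≤ N m + 1` contribute. -/
theorem sum_stepBump {N m : ℕ} (hN : 0 < N) {t : ℝ} (ht : |t| ≤ m) :
    ∑ k ∈ Finset.Ico (-((N * m + 2 : ℕ) : ℤ)) (N * m + 2 : ℕ), stepBump N (k / N - t) = 1 := by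
  have hN' : (0 : ℝ) < N := Nat.cast_pos.2 hN
  have h := Finset.sum_Ico_int_sub (N * m + 2) fun k : ℤ => Real.smoothTransition (k - N * t)
  have hterm : ∀ k : ℤ, stepBump N (k / N - t) = -(Real.smoothTransition (k - N * t) -
      Real.smoothTransition ((k + 1 : ℤ) - N * t)) := fun k => by
    rw [stepBump, mul_sub, mul_div_cancel₀ _ hN'.ne', neg_sub]
    push_cast
    congr 2
    ring
  have h1 : (N : ℝ) * |t| ≤ N * m := mul_le_mul_of_nonneg_left ht hN'.le
  have h2 : |(N : ℝ) * t| = N * |t| := by rw [abs_mul, Nat.abs_cast]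
  have h3 := abs_le.1 (h2.le.trans h1)
  simp_rw [hterm]
  rw [Finset.sum_neg_distrib, h, Real.smoothTransition.zero_of_nonpos,
    Real.smoothTransition.one_of_one_le]
  · norm_num
  · push_cast; linarith [h3.2]
  · push_cast; linarith [h3.1]

/-- For large `N`, `η` does not vanish near the support of `stepBump N`, so that the quotient is a
test function. -/
theorem exists_div_stepBump {η : CTest} (hη : η 0 = 1) :
    ∃ N : ℕ, 0 < N ∧ ∃ θ : CTest, (∀ s, η s * θ s = (stepBump N s : ℂ)) ∧
      (∀ s, 1 < |(N : ℝ) * s| → θ s = 0) ∧ ∀ s, 1 < |(N : ℝ) * s| → deriv θ s = 0 := by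
  have hne : ∀ᶠ s in 𝓝 (0 : ℝ), η s ≠ 0 :=
    η.continuous.continuousAt.eventually_ne (by rw [hη]; exact one_ne_zero)
  obtain ⟨δ, hδ, hball⟩ := Metric.eventually_nhds_iff.1 hne
  obtain ⟨N, hN⟩ := exists_nat_gt (2 / δ)
  have hN0 : (0 : ℝ) < N := (by positivity : 0 < 2 / δ).trans hN
  have hηne : ∀ s, |(N : ℝ) * s| < 2 → η s ≠ 0 := fun s hs => hball (by
    rw [Real.dist_eq, sub_zero]
    rw [abs_mul, Nat.abs_cast] at hs
    rw [div_lt_iff₀ hδ] at hN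
    by_contra! h
    nlinarith)
  have hopen : ∀ s, 1 < |(N : ℝ) * s| → ∀ᶠ r in 𝓝 s, (stepBump N r : ℂ) / η r = 0 := fun s hs => by
    have : Continuous fun r : ℝ => |(N : ℝ) * r| := by fun_prop
    filter_upwards [this.continuousAt.eventually (lt_mem_nhds hs)] with r hr
    rw [stepBump_eq_zero hr.le]
    simp
  have hsm : ContDiff ℝ ((⊤ : ℕ∞) : WithTop ℕ∞) fun s => (stepBump N s : ℂ) / η s := by
    rw [contDiff_iff_contDiffAt]
    intro s
    rcases lt_or_ge |(N : ℝ) * s| 2 with hs | hs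
    · simp_rw [div_eq_mul_inv]
      exact (Complex.ofRealCLM.contDiff.comp (contDiff_stepBump N)).contDiffAt.mul
        (η.contDiff.contDiffAt.inv (hηne s hs))
    · exact contDiffAt_const.congr_of_eventuallyEq (hopen s (by linarith))
  have hcs : HasCompactSupport fun s => (stepBump N s : ℂ) / η s := by
    refine HasCompactSupport.intro (isCompact_Icc (a := -(1 / (N : ℝ))) (b := 1 / N)) fun s hs => ?_
    rw [stepBump_eq_zero]
    · simp
    · by_contra! h
      rw [abs_lt] at h
      refine hs ⟨?_, ?_⟩
      · rw [neg_le_iff_add_nonneg, ← sub_nonneg]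
        have : s + 1 / N - 0 = (N * s + 1) / N := by field_simp; ring
        rw [this]
        exact div_nonneg (by linarith [h.1]) hN0.le
      · rw [le_div_iff₀ hN0]
        linarith [h.2]
  refine ⟨N, Nat.cast_pos.1 hN0, testOf _ hsm hcs, fun s => ?_, fun s hs => ?_, fun s hs => ?_⟩
  · rw [testOf_apply]
    rcases lt_or_ge |(N : ℝ) * s| 2 with hs | hs
    · exact mul_div_cancel₀ _ (hηne s hs)
    · rw [stepBump_eq_zero (by linarith)]
      simp
  · exact (hopen s hs).self_of_nhds
  · have : (testOf _ hsm hcs : CTest) =ᶠ[𝓝 s] fun _ => (0 : ℂ) := hopen s hs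
    rw [this.deriv_eq, deriv_const]

/-! ### From the uniform dual norm to a representation -/

/-- A real-valued test function regarded as a complex-valued one. -/
noncomputable def complexify (φ : RTest) : CTest := TestFunction.postcompCLM Complex.ofRealCLM φ

theorem complexify_apply (φ : RTest) (x : ℝ) : complexify φ x = (φ x : ℂ) := rfl

theorem deriv_complexify (φ : RTest) (x : ℝ) : deriv (complexify φ) x = ((deriv φ x : ℝ) : ℂ) :=
  ((differentiable_test φ x).hasDerivAt.ofReal_comp).deriv

theorem deriv_translateMul (θ φ : CTest) (x t : ℝ) :
    deriv (translateMul θ x φ) t = -deriv θ (x - t) * φ t + θ (x - t) * deriv φ t :=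
  (((differentiable_test θ (x - t)).hasDerivAt.comp_const_sub x t).mul
    (differentiable_test φ t).hasDerivAt).deriv

theorem sum_test_apply {ι : Type*} (s : Finset ι) (f : ι → RTest) (t : ℝ) :
    (∑ k ∈ s, f k) t = ∑ k ∈ s, f k t :=
  map_sum ({ toFun := fun f => f t, map_zero' := rfl, map_add' := fun _ _ => rfl } : RTest →+ ℝ) f s

theorem test_eq_zero_of_lt_abs (φ : RTest) :
    ∃ m : ℕ, ∀ t, (m : ℝ) < |t| → φ t = 0 ∧ deriv φ t = 0 := by
  obtain ⟨R, hR⟩ := φ.hasCompactSupport.isCompact.isBounded.exists_norm_le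
  obtain ⟨m, hm⟩ := exists_nat_ge R
  refine ⟨m, fun t ht => ?_⟩
  have h : t ∉ tsupport φ := fun h => absurd (hR t h) (by rw [Real.norm_eq_abs]; linarith)
  exact ⟨image_eq_zero_of_notMem_tsupport h,
    image_eq_zero_of_notMem_tsupport fun h' => h (tsupport_deriv_subset h')⟩

theorem sq_norm_mul_add_mul_le {B : ℝ} (x y g h : ℂ) (hx : ‖x‖ ≤ B) (hy : ‖y‖ ≤ B) :
    ‖x * g + y * h‖ ^ 2 ≤ 2 * B ^ 2 * (‖g‖ ^ 2 + ‖h‖ ^ 2) := by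
  have h1 : ‖x * g + y * h‖ ≤ B * (‖g‖ + ‖h‖) := by
    refine (norm_add_le _ _).trans ?_
    rw [norm_mul, norm_mul, mul_add]
    gcongr
  have hB : 0 ≤ B := (norm_nonneg x).trans hx
  calc ‖x * g + y * h‖ ^ 2 ≤ (B * (‖g‖ + ‖h‖)) ^ 2 := by gcongr
    _ ≤ 2 * B ^ 2 * (‖g‖ ^ 2 + ‖h‖ ^ 2) := by
      nlinarith [mul_nonneg (sq_nonneg B) (sq_nonneg (‖g‖ - ‖h‖))]

theorem lintegral_sq_mul_add_mul_le {x y g h : ℝ → ℂ} {B M : ℝ} (hx : ∀ t, ‖x t‖ ≤ B)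
    (hy : ∀ t, ‖y t‖ ≤ B) (hg : MemLp g 2 (volume : Measure ℝ))
    (hgM : ∫⁻ t, ‖g t‖ₑ ^ 2 ≤ ENNReal.ofReal (M ^ 2))
    (hhM : ∫⁻ t, ‖h t‖ₑ ^ 2 ≤ ENNReal.ofReal (M ^ 2)) :
    ∫⁻ t, ‖x t * g t + y t * h t‖ₑ ^ 2 ≤
      ENNReal.ofReal (2 * B ^ 2) * (ENNReal.ofReal (M ^ 2) + ENNReal.ofReal (M ^ 2)) := by
  calc ∫⁻ t, ‖x t * g t + y t * h t‖ₑ ^ 2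
      ≤ ∫⁻ t, ENNReal.ofReal (2 * B ^ 2) * (‖g t‖ₑ ^ 2 + ‖h t‖ₑ ^ 2) := by
        refine lintegral_mono fun t => ?_
        rw [← ofReal_norm, ← ofReal_norm, ← ofReal_norm, ← ENNReal.ofReal_pow (norm_nonneg _),
          ← ENNReal.ofReal_pow (norm_nonneg _), ← ENNReal.ofReal_pow (norm_nonneg _),
          ← ENNReal.ofReal_add (by positivity) (by positivity),
          ← ENNReal.ofReal_mul (by positivity)]
        exact ENNReal.ofReal_le_ofReal (sq_norm_mul_add_mul_le _ _ _ _ (hx t) (hy t))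
    _ ≤ _ := by
        rw [lintegral_const_mul' _ _ ENNReal.ofReal_ne_top,
          lintegral_add_left' (hg.1.enorm.pow_const 2)]
        gcongr

theorem memLp_two_of_lintegral_sq_lt_top {f : ℝ → ℂ} (hf : AEStronglyMeasurable f volume)
    (h : ∫⁻ t, ‖f t‖ₑ ^ 2 < ∞) : MemLp f 2 (volume : Measure ℝ) := by
  refine ⟨hf, ?_⟩
  have h2 := eLpNorm_nnreal_pow_eq_lintegral (f := f) (μ := volume) (p := 2) (by norm_num)
  simp only [NNReal.coe_ofNat, ENNReal.coe_ofNat, ENNReal.rpow_ofNat] at h2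
  rw [← h2] at h
  by_contra hn
  rw [not_lt, top_le_iff] at hn
  simp [hn] at h

theorem MemUnif.hasRepresentation {V : Distr} {η : CTest} (hη : η 0 = 1) (hV : MemUnif η V) :
    HasRepresentation V := by
  obtain ⟨M, hM0, hM⟩ := hV.exists_bound
  obtain ⟨N, hN, θ, hθ, hθ0, hθ'0⟩ := exists_div_stepBump hη
  have hN0 : (0 : ℝ) < N := Nat.cast_pos.2 hN
  choose g h hg hh hgM hhM hrep using fun k : ℤ =>
    exists_l2_representation (localized V η (k / N)) (hM (k / N)) hM0
  obtain ⟨B₁, hB₁⟩ := θ.hasCompactSupport.exists_bound_of_continuous θ.continuous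
  obtain ⟨B₂, hB₂⟩ := θ.hasCompactSupport.deriv.exists_bound_of_continuous (continuous_deriv_test θ)
  set B := max B₁ B₂ with hB
  have hBθ : ∀ s, ‖θ s‖ ≤ B := fun s => (hB₁ s).trans (le_max_left _ _)
  have hBθ' : ∀ s, ‖-deriv θ s‖ ≤ B := fun s => by
    rw [norm_neg]; exact (hB₂ s).trans (le_max_right _ _)
  set A : ℝ≥0∞ := ENNReal.ofReal (2 * B ^ 2) * (ENNReal.ofReal (M ^ 2) + ENNReal.ofReal (M ^ 2))
    with hA
  have hAtop : A ≠ ∞ := ENNReal.mul_ne_top ENNReal.ofReal_ne_top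
    (ENNReal.add_ne_top.2 ⟨ENNReal.ofReal_ne_top, ENNReal.ofReal_ne_top⟩)
  have hcθ : ∀ k : ℤ, Continuous fun t : ℝ => θ (k / N - t) := fun k =>
    θ.continuous.comp (by fun_prop)
  have hcθ' : ∀ k : ℤ, Continuous fun t : ℝ => -deriv θ (k / N - t) := fun k =>
    ((continuous_deriv_test θ).comp (by fun_prop)).neg
  have hdist : ∀ (k : ℤ) (t : ℝ), (N : ℝ) * (k / N - t) = k - N * t := fun k t => by
    rw [mul_sub, mul_div_cancel₀ _ hN0.ne']
  -- `g_k - h_k'` multiplied by `θ(k / N - ·)` is `a_k - b_k'`.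
  set a : ℤ → ℝ → ℂ := fun k t => θ (k / N - t) * g k t + -deriv θ (k / N - t) * h k t with ha
  set b : ℤ → ℝ → ℂ := fun k t => θ (k / N - t) * h k t with hb
  have ham : ∀ k, AEStronglyMeasurable (a k) volume := fun k =>
    ((hcθ k).aestronglyMeasurable.mul (hg k).1).add ((hcθ' k).aestronglyMeasurable.mul (hh k).1)
  have hbm : ∀ k, AEStronglyMeasurable (b k) volume := fun k =>
    (hcθ k).aestronglyMeasurable.mul (hh k).1
  have haA : ∀ k, ∫⁻ t, ‖a k t‖ₑ ^ 2 ≤ A := fun k =>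
    lintegral_sq_mul_add_mul_le (fun t => hBθ _) (fun t => hBθ' _) (hg k) (hgM k) (hhM k)
  have hbA : ∀ k, ∫⁻ t, ‖b k t‖ₑ ^ 2 ≤ A := fun k => by
    have := lintegral_sq_mul_add_mul_le (x := fun t => θ (k / N - t)) (y := fun _ => 0) (B := B)
      (fun t => hBθ _) (fun t => by simpa using (norm_nonneg _).trans (hBθ 0))
      (hh k) (hhM k) (hgM k)
    simpa only [zero_mul, add_zero] using this
  have haL : ∀ k, MemLp (a k) 2 volume := fun k =>
    memLp_two_of_lintegral_sq_lt_top (ham k) ((haA k).trans_lt hAtop.lt_top)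
  have hbL : ∀ k, MemLp (b k) 2 volume := fun k =>
    memLp_two_of_lintegral_sq_lt_top (hbm k) ((hbA k).trans_lt hAtop.lt_top)
  have hbs : ∀ (k : ℤ) (t : ℝ), 1 < |(k : ℝ) - N * t| → b k t = 0 := fun k t hk => by
    rw [← hdist] at hk
    simp only [hb, hθ0 _ hk, zero_mul]
  have has : ∀ (k : ℤ) (t : ℝ), 1 < |(k : ℝ) - N * t| → a k t = 0 := fun k t hk => by
    rw [← hdist] at hk
    simp only [ha, hθ0 _ hk, hθ'0 _ hk, zero_mul, neg_zero, add_zero]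
  set G : ℝ → ℂ := fun t => ∑' k, a k t with hG
  set H : ℝ → ℂ := fun t => ∑' k, b k t with hH
  have hunif : UnifLocBounded (fun t => -H t) G := by
    have hGm : AEStronglyMeasurable G volume := aestronglyMeasurable_tsum ham has
    have hHm : AEStronglyMeasurable H volume := aestronglyMeasurable_tsum hbm hbs
    refine unifLocBounded_of_le hHm.neg hGm
      (M := ((N + 4 : ℕ) : ℝ≥0∞) ^ 2 * A + (1 + ((N + 4 : ℕ) : ℝ≥0∞) ^ 2 * A)) ?_ fun x => ?_
    · have : ((N + 4 : ℕ) : ℝ≥0∞) ^ 2 * A ≠ ∞ :=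
        ENNReal.mul_ne_top (ENNReal.pow_ne_top (ENNReal.natCast_ne_top _)) hAtop
      exact ENNReal.add_ne_top.2 ⟨this, ENNReal.add_ne_top.2 ⟨ENNReal.one_ne_top, this⟩⟩
    · simp_rw [enorm_neg]
      rw [lintegral_add_left' (hHm.restrict.enorm.pow_const 2)]
      refine add_le_add (lintegral_sq_tsum_le hbm hbA hbs x) ?_
      refine (lintegral_mono fun t => enorm_le_one_add_sq (G t)).trans ?_
      rw [lintegral_add_left measurable_const]
      refine add_le_add (by simp) (lintegral_sq_tsum_le ham haA has x)
  refine ⟨fun t => -H t, G, hunif, ?_⟩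
  ext φ
  rw [representation_apply hunif]
  obtain ⟨m, hm⟩ := test_eq_zero_of_lt_abs φ
  set I : Finset ℤ := Finset.Ico (-((N * m + 2 : ℕ) : ℤ)) (N * m + 2 : ℕ) with hI
  set P : ℤ → CTest := fun k => translateMul θ (k / N) (complexify φ) with hP
  have hPη : ∀ k : ℤ, ∀ t,
      translateMul η (k / N) (P k) t = ((stepBump N (k / N - t) * φ t : ℝ) : ℂ) := by
    intro k t
    change η _ * (θ _ * (φ t : ℂ)) = _
    rw [← mul_assoc, hθ, Complex.ofReal_mul]
  have hdecomp : φ = ∑ k ∈ I,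
      TestFunction.postcompCLM Complex.reCLM (translateMul η (k / N) (P k)) := by
    ext t
    have hsum : (∑ k ∈ I, TestFunction.postcompCLM Complex.reCLM
        (translateMul η (k / N) (P k))) t = ∑ k ∈ I, stepBump N (k / N - t) * φ t := by
      rw [sum_test_apply]
      refine Finset.sum_congr rfl fun k _ => ?_
      change (translateMul η (k / N) (P k) t).re = _
      rw [hPη, Complex.ofReal_re]
    rw [hsum, ← Finset.sum_mul]
    rcases le_or_gt |t| m with ht | ht
    · rw [sum_stepBump hN ht, one_mul]
    · rw [(hm t ht).1, mul_zero]
  have hloc : ∀ k : ℤ, localized V η (k / N) (P k) =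
      V (TestFunction.postcompCLM Complex.reCLM (translateMul η (k / N) (P k))) := fun k => by
    have him :
        TestFunction.postcompCLM Complex.imCLM (translateMul η (k / N) (P k)) = (0 : RTest) := by
      ext t
      change (translateMul η (k / N) (P k) t).im = 0
      rw [hPη, Complex.ofReal_im]
    change pairing V _ = _
    rw [pairing, him, map_zero, mul_zero, add_zero]
  have hφL : MemLp (fun t => ((φ t : ℝ) : ℂ)) 2 volume := memLp_test (complexify φ)
  have hφ'L : MemLp (fun t => ((deriv φ t : ℝ) : ℂ)) 2 volume := (memLp_deriv_test φ).ofReal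
  have hGint := integral_mul_tsum (m := m) haL has hφL fun t ht => by simp [(hm t ht).1]
  have hHint := integral_mul_tsum (m := m) hbL hbs hφ'L fun t ht => by simp [(hm t ht).2]
  calc V φ = ∑ k ∈ I, localized V η (k / N) (P k) := by
        conv_lhs => rw [hdecomp]
        rw [map_sum]
        exact Finset.sum_congr rfl fun k _ => (hloc k).symm
    _ = ∑ k ∈ I, ((∫ t, ((φ t : ℝ) : ℂ) * a k t) + ∫ t, ((deriv φ t : ℝ) : ℂ) * b k t) := by
        refine Finset.sum_congr rfl fun k _ => ?_
        have i1 : Integrable fun t => ((φ t : ℝ) : ℂ) * a k t := hφL.integrable_mul (haL k)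
        have i2 : Integrable fun t => ((deriv φ t : ℝ) : ℂ) * b k t := hφ'L.integrable_mul (hbL k)
        rw [hrep, ← integral_add i1 i2]
        refine integral_congr_ae (ae_of_all _ fun t => ?_)
        have e1 : P k t = θ (k / N - t) * (φ t : ℂ) := rfl
        have e2 : deriv (P k) t = _ := deriv_translateMul θ (complexify φ) (k / N) t
        rw [deriv_complexify, complexify_apply] at e2
        simp only [e1, e2, ha, hb]
        ring
    _ = (∫ t, ((φ t : ℝ) : ℂ) * G t) + ∫ t, ((deriv φ t : ℝ) : ℂ) * H t := by
        rw [Finset.sum_add_distrib, hGint, hHint]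
    _ = _ := by
        simp_rw [mul_neg, integral_neg]
        rw [neg_neg, add_comm]

/-! ### Convolution of test functions with exponentially decaying kernels -/

/-- A measurable kernel dominated by `e^{-|x|}`. -/
structure IsExpBounded (k : ℝ → ℝ) : Prop where
  measurable : Measurable k
  abs_le : ∀ y, |k y| ≤ expKernel y

theorem isExpBounded_expKernel : IsExpBounded expKernel where
  measurable := by unfold expKernel; fun_prop
  abs_le y := (abs_of_nonneg (Real.exp_pos _).le).le

theorem isExpBounded_signExpKernel : IsExpBounded signExpKernel where
  measurable := by
    have hs : Measurable Real.sign :=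
      Measurable.ite measurableSet_Iio measurable_const
        (Measurable.ite measurableSet_Ioi measurable_const measurable_const)
    exact hs.mul (by fun_prop)
  abs_le y := by
    unfold signExpKernel expKernel
    rw [abs_mul, abs_of_nonneg (Real.exp_pos _).le]
    refine mul_le_of_le_one_left (Real.exp_pos _).le ?_
    rcases Real.sign_apply_eq y with h | h | h <;> simp [h]

/-- The function `t ↦ ∫ k(x - t) φ(x) dx`. -/
noncomputable def kerConv (k : ℝ → ℝ) (φ : ℝ → ℝ) (t : ℝ) : ℝ := ∫ x : ℝ, k (x - t) * φ x

theorem kerConv_eq (k φ : ℝ → ℝ) (t : ℝ) : kerConv k φ t = ∫ y, k y * φ (y + t) := by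
  rw [kerConv, ← integral_add_right_eq_self (fun x => k (x - t) * φ x) t]
  simp

theorem expKernel_sub_le (x t : ℝ) : expKernel (x - t) ≤ Real.exp |x| * expKernel t := by
  rw [expKernel, expKernel, ← Real.exp_add, Real.exp_le_exp]
  have h : |t| ≤ |x - t| + |x| := by
    have h' := abs_sub_le t x 0
    rw [sub_zero, sub_zero, abs_sub_comm t x] at h'
    exact h'
  linarith

theorem integrable_exp_abs_mul {φ : ℝ → ℝ} (hφ : Continuous φ) (hc : HasCompactSupport φ) :
    Integrable fun x => Real.exp |x| * |φ x| :=
  Continuous.integrable_of_hasCompactSupport (by fun_prop) hc.abs.mul_left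

theorem abs_kerConv_le {k : ℝ → ℝ} (hk : IsExpBounded k) {φ : ℝ → ℝ} (hφ : Continuous φ)
    (hc : HasCompactSupport φ) (t : ℝ) :
    |kerConv k φ t| ≤ (∫ x, Real.exp |x| * |φ x|) * expKernel t := by
  rw [← integral_mul_const, ← Real.norm_eq_abs]
  refine norm_integral_le_of_norm_le ((integrable_exp_abs_mul hφ hc).mul_const _)
    (ae_of_all _ fun x => ?_)
  rw [Real.norm_eq_abs, abs_mul, mul_right_comm]
  exact mul_le_mul_of_nonneg_right ((hk.abs_le _).trans (expKernel_sub_le x t)) (abs_nonneg _)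

theorem IsExpBounded.locallyIntegrable_comp_neg {k : ℝ → ℝ} (hk : IsExpBounded k) :
    LocallyIntegrable fun y => k (-y) :=
  locallyIntegrable_expKernel.mono (hk.measurable.comp measurable_neg).aestronglyMeasurable
    (ae_of_all _ fun y => by
      rw [Real.norm_eq_abs, Real.norm_eq_abs]
      refine (hk.abs_le _).trans (le_of_eq ?_)
      rw [expKernel, expKernel, abs_neg, Real.abs_exp])

theorem kerConv_eq_convolution (k φ : ℝ → ℝ) :
    kerConv k φ = convolution (fun y => k (-y)) φ (ContinuousLinearMap.mul ℝ ℝ) volume := by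
  ext t
  rw [convolution_def, kerConv, ← integral_sub_left_eq_self (fun x : ℝ => k (x - t) * φ x) volume t]
  simp

theorem hasDerivAt_kerConv {k : ℝ → ℝ} (hk : IsExpBounded k) (φ : RTest) (t : ℝ) :
    HasDerivAt (kerConv k φ) (kerConv k (deriv φ) t) t := by
  rw [kerConv_eq_convolution, kerConv_eq_convolution]
  exact φ.hasCompactSupport.hasDerivAt_convolution_right _ hk.locallyIntegrable_comp_neg
    (φ.contDiff.of_le (by simp)) t

theorem integral_Ioi_exp_neg_mul_deriv (φ : RTest) (t : ℝ) :
    ∫ y in Set.Ioi (0 : ℝ), Real.exp (-y) * deriv φ (y + t) =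
      (∫ y in Set.Ioi (0 : ℝ), Real.exp (-y) * φ (y + t)) - φ t := by
  have hc : HasCompactSupport fun y => Real.exp (-y) * φ (y + t) :=
    (φ.hasCompactSupport.comp_homeomorph (Homeomorph.addRight t)).mul_left
  have hs : ContDiff ℝ 1 fun y => Real.exp (-y) * φ (y + t) :=
    (Real.contDiff_exp.comp contDiff_neg).mul
      ((φ.contDiff.of_le (by simp)).comp (contDiff_id.add contDiff_const))
  have hd : ∀ y, deriv (fun y => Real.exp (-y) * φ (y + t)) y =
      Real.exp (-y) * deriv φ (y + t) - Real.exp (-y) * φ (y + t) := fun y => by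
    have h := ((hasDerivAt_neg y).exp.mul
      ((differentiable_test φ (y + t)).hasDerivAt.comp_add_const y t))
    exact h.deriv.trans (by ring)
  have hi : Integrable fun y => Real.exp (-y) * φ (y + t) :=
    hs.continuous.integrable_of_hasCompactSupport hc
  have hi' : Integrable fun y => Real.exp (-y) * deriv φ (y + t) :=
    Continuous.integrable_of_hasCompactSupport
      ((Real.continuous_exp.comp continuous_neg).mul
        ((continuous_deriv_test φ).comp (continuous_id.add continuous_const)))
      (φ.hasCompactSupport.deriv.comp_homeomorph (Homeomorph.addRight t)).mul_left
  have h := hc.integral_Ioi_deriv_eq hs 0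
  simp_rw [hd] at h
  rw [integral_sub hi'.integrableOn hi.integrableOn, zero_add, neg_zero, Real.exp_zero,
    one_mul] at h
  linarith

theorem integral_Iic_exp_mul_deriv (φ : RTest) (t : ℝ) :
    ∫ y in Set.Iic (0 : ℝ), Real.exp y * deriv φ (y + t) =
      φ t - ∫ y in Set.Iic (0 : ℝ), Real.exp y * φ (y + t) := by
  have hc : HasCompactSupport fun y => Real.exp y * φ (y + t) :=
    (φ.hasCompactSupport.comp_homeomorph (Homeomorph.addRight t)).mul_left
  have hs : ContDiff ℝ 1 fun y => Real.exp y * φ (y + t) :=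
    Real.contDiff_exp.mul ((φ.contDiff.of_le (by simp)).comp (contDiff_id.add contDiff_const))
  have hd : ∀ y, deriv (fun y => Real.exp y * φ (y + t)) y =
      Real.exp y * φ (y + t) + Real.exp y * deriv φ (y + t) := fun y =>
    ((Real.hasDerivAt_exp y).mul
      ((differentiable_test φ (y + t)).hasDerivAt.comp_add_const y t)).deriv
  have hi : Integrable fun y => Real.exp y * φ (y + t) :=
    hs.continuous.integrable_of_hasCompactSupport hc
  have hi' : Integrable fun y => Real.exp y * deriv φ (y + t) :=
    Continuous.integrable_of_hasCompactSupport
      (Real.continuous_exp.mul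
        ((continuous_deriv_test φ).comp (continuous_id.add continuous_const)))
      (φ.hasCompactSupport.deriv.comp_homeomorph (Homeomorph.addRight t)).mul_left
  have h := hc.integral_Iic_deriv_eq hs 0
  simp_rw [hd] at h
  rw [integral_add hi.integrableOn hi'.integrableOn, zero_add, Real.exp_zero, one_mul] at h
  linarith

theorem integrable_kernel_mul {k : ℝ → ℝ} (hk : IsExpBounded k) {f : ℝ → ℝ} (hf : Continuous f)
    (hc : HasCompactSupport f) : Integrable fun y => k y * f y := by
  have hi : Integrable fun y => expKernel y * f y :=
    Continuous.integrable_of_hasCompactSupport (by unfold expKernel; fun_prop) hc.mul_left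
  refine hi.mono (hk.measurable.aestronglyMeasurable.mul hf.aestronglyMeasurable)
    (ae_of_all _ fun y => ?_)
  rw [norm_mul, norm_mul]
  exact mul_le_mul_of_nonneg_right ((hk.abs_le y).trans (le_abs_self _)) (norm_nonneg _)

theorem kerConv_expKernel {φ : ℝ → ℝ} (hφ : Continuous φ) (hc : HasCompactSupport φ) (t : ℝ) :
    kerConv expKernel φ t = (∫ y in Set.Iic (0 : ℝ), Real.exp y * φ (y + t)) +
      ∫ y in Set.Ioi (0 : ℝ), Real.exp (-y) * φ (y + t) := by
  have hi : Integrable fun y => expKernel y * φ (y + t) :=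
    integrable_kernel_mul isExpBounded_expKernel (by fun_prop)
      (hc.comp_homeomorph (Homeomorph.addRight t))
  rw [kerConv_eq, ← intervalIntegral.integral_Iic_add_Ioi hi.integrableOn hi.integrableOn]
  congr 1
  · refine setIntegral_congr_fun measurableSet_Iic fun y hy => ?_
    simp only [expKernel, abs_of_nonpos (show y ≤ 0 from hy), neg_neg]
  · refine setIntegral_congr_fun measurableSet_Ioi fun y hy => ?_
    simp only [expKernel, abs_of_pos (show 0 < y from hy)]

theorem kerConv_signExpKernel {φ : ℝ → ℝ} (hφ : Continuous φ) (hc : HasCompactSupport φ) (t : ℝ) :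
    kerConv signExpKernel φ t = -(∫ y in Set.Iic (0 : ℝ), Real.exp y * φ (y + t)) +
      ∫ y in Set.Ioi (0 : ℝ), Real.exp (-y) * φ (y + t) := by
  have hi : Integrable fun y => signExpKernel y * φ (y + t) :=
    integrable_kernel_mul isExpBounded_signExpKernel (by fun_prop)
      (hc.comp_homeomorph (Homeomorph.addRight t))
  rw [kerConv_eq, ← intervalIntegral.integral_Iic_add_Ioi hi.integrableOn hi.integrableOn]
  congr 1
  · rw [← integral_neg, integral_Iic_eq_integral_Iio, integral_Iic_eq_integral_Iio]
    refine setIntegral_congr_fun measurableSet_Iio fun y hy => ?_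
    simp only [signExpKernel, abs_of_neg (show y < 0 from hy), neg_neg,
      Real.sign_of_neg (show y < 0 from hy)]
    ring
  · refine setIntegral_congr_fun measurableSet_Ioi fun y hy => ?_
    simp only [signExpKernel, abs_of_pos (show 0 < y from hy),
      Real.sign_of_pos (show 0 < y from hy), one_mul]

/-- `(e^{-|·|})' = -sign e^{-|·|}`, integrated by parts. -/
theorem kerConv_expKernel_deriv (φ : RTest) (t : ℝ) :
    kerConv expKernel (deriv φ) t = kerConv signExpKernel φ t := by
  rw [kerConv_expKernel (continuous_deriv_test φ) φ.hasCompactSupport.deriv,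
    kerConv_signExpKernel φ.continuous φ.hasCompactSupport, integral_Ioi_exp_neg_mul_deriv,
    integral_Iic_exp_mul_deriv]
  ring

/-- `(sign e^{-|·|})' = 2 δ - e^{-|·|}`, integrated by parts. -/
theorem kerConv_signExpKernel_deriv (φ : RTest) (t : ℝ) :
    kerConv signExpKernel (deriv φ) t = -2 * φ t + kerConv expKernel φ t := by
  rw [kerConv_signExpKernel (continuous_deriv_test φ) φ.hasCompactSupport.deriv,
    kerConv_expKernel φ.continuous φ.hasCompactSupport, integral_Ioi_exp_neg_mul_deriv,
    integral_Iic_exp_mul_deriv]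
  ring

/-! ### Convolution of uniformly locally integrable functions with such kernels -/

theorem integrable_expKernel : Integrable expKernel := by
  have h1 : IntegrableOn expKernel (Set.Iic 0) :=
    (integrableOn_exp_Iic 0).congr_fun (fun y hy => by
      simp only [expKernel, abs_of_nonpos (show y ≤ 0 from hy), neg_neg]) measurableSet_Iic
  have h2 : IntegrableOn expKernel (Set.Ioi 0) :=
    (integrableOn_exp_neg_Ioi 0).congr_fun (fun y hy => by
      simp only [expKernel, abs_of_pos (show 0 < y from hy)]) measurableSet_Ioi
  rw [← integrableOn_univ, ← Set.Iic_union_Ioi (a := (0 : ℝ))]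
  exact h1.union h2

/-- The convolution of `e^{-|·|}` with a weight that has bounded integrals over unit intervals is
bounded, since `e^{-|x - t|} ≤ e · e^{-|x - s|}` for `s ∈ [t - 1, t]`. -/
theorem exists_lintegral_expKernel_mul_le {w : ℝ → ℝ≥0∞} {M : ℝ} (hw : AEMeasurable w)
    (hM : ∀ x, ∫⁻ t in Set.Icc x (x + 1), w t ≤ ENNReal.ofReal M) :
    ∃ C : ℝ, 0 ≤ C ∧
      ∀ x, ∫⁻ t, ENNReal.ofReal (expKernel (x - t)) * w t ≤ ENNReal.ofReal C := by
  set C₀ : ℝ≥0∞ := ENNReal.ofReal M *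
    (ENNReal.ofReal (Real.exp 1) * ∫⁻ s, ENNReal.ofReal (expKernel s)) with hC₀
  have hfin : C₀ ≠ ∞ := by
    refine ENNReal.mul_ne_top ENNReal.ofReal_ne_top
      (ENNReal.mul_ne_top ENNReal.ofReal_ne_top ?_)
    rw [← ofReal_integral_eq_lintegral_ofReal integrable_expKernel
      (ae_of_all _ fun y => (Real.exp_pos _).le)]
    exact ENNReal.ofReal_ne_top
  have hme : Measurable fun s => ENNReal.ofReal (expKernel s) :=
    ENNReal.measurable_ofReal.comp isExpBounded_expKernel.measurable
  refine ⟨C₀.toReal, ENNReal.toReal_nonneg, fun x => ?_⟩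
  rw [ENNReal.ofReal_toReal hfin]
  refine (lintegral_mul_le_of_le_average hw hM (g := fun s => ENNReal.ofReal (Real.exp 1) *
    ENNReal.ofReal (expKernel (x - s))) ((hme.comp (by fun_prop)).const_mul _)
      fun t => ?_).trans (le_of_eq ?_)
  · have hle : ∀ s ∈ Set.Icc (t - 1) t, ENNReal.ofReal (expKernel (x - t)) ≤
        ENNReal.ofReal (Real.exp 1) * ENNReal.ofReal (expKernel (x - s)) := fun s hs => by
      rw [← ENNReal.ofReal_mul (Real.exp_pos _).le]
      refine ENNReal.ofReal_le_ofReal ?_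
      rw [expKernel, expKernel, ← Real.exp_add, Real.exp_le_exp]
      have h1 : |x - s| ≤ |x - t| + |t - s| := abs_sub_le x t s
      have h2 : |t - s| ≤ 1 := abs_le.2 ⟨by linarith [hs.2], by linarith [hs.1]⟩
      linarith
    calc ENNReal.ofReal (expKernel (x - t))
        = ∫⁻ _ in Set.Icc (t - 1) t, ENNReal.ofReal (expKernel (x - t)) := by simp
      _ ≤ _ := setLIntegral_mono' measurableSet_Icc hle
  · rw [lintegral_const_mul' _ _ ENNReal.ofReal_ne_top,
      lintegral_sub_left_eq_self (fun s => ENNReal.ofReal (expKernel s)) x]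

/-- The function `x ↦ ∫ k(x - t) f(t) dt`. -/
noncomputable def funConv (k : ℝ → ℝ) (f : ℝ → ℂ) (x : ℝ) : ℂ := ∫ t : ℝ, (k (x - t) : ℂ) * f t

section FunConv

variable {k : ℝ → ℝ} {f : ℝ → ℂ} {w : ℝ → ℝ≥0∞} {C : ℝ}

theorem enorm_kernel_mul_le (hk : IsExpBounded k) (hfw : ∀ t, ‖f t‖ₑ ≤ w t) (x t : ℝ) :
    ‖(k (x - t) : ℂ) * f t‖ₑ ≤ ENNReal.ofReal (expKernel (x - t)) * w t := by
  rw [enorm_mul, ← ofReal_norm, Complex.norm_real, Real.norm_eq_abs]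
  exact mul_le_mul' (ENNReal.ofReal_le_ofReal (hk.abs_le _)) (hfw t)

theorem norm_funConv_le (hk : IsExpBounded k) (hfw : ∀ t, ‖f t‖ₑ ≤ w t) (hC0 : 0 ≤ C)
    (hC : ∀ x, ∫⁻ t, ENNReal.ofReal (expKernel (x - t)) * w t ≤ ENNReal.ofReal C) (x : ℝ) :
    ‖funConv k f x‖ ≤ C := by
  rw [← ENNReal.ofReal_le_ofReal_iff hC0, ofReal_norm]
  exact (enorm_integral_le_lintegral_enorm _).trans
    ((lintegral_mono fun t => enorm_kernel_mul_le hk hfw x t).trans (hC x))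

theorem aestronglyMeasurable_kernel_mul (hk : IsExpBounded k)
    (hf : AEStronglyMeasurable f volume) :
    AEStronglyMeasurable (fun p : ℝ × ℝ => (k (p.1 - p.2) : ℂ) * f p.2)
      ((volume : Measure ℝ).prod volume) :=
  (Complex.measurable_ofReal.comp (hk.measurable.comp
    (measurable_fst.sub measurable_snd))).aestronglyMeasurable.mul hf.comp_snd

theorem aestronglyMeasurable_funConv (hk : IsExpBounded k) (hf : AEStronglyMeasurable f volume) :
    AEStronglyMeasurable (funConv k f) volume :=
  (aestronglyMeasurable_kernel_mul hk hf).integral_prod_right'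

/-- Fubini: the convolution can be moved from the test function to the function. -/
theorem integral_kerConv_mul (hk : IsExpBounded k) (hf : AEStronglyMeasurable f volume)
    (hfw : ∀ t, ‖f t‖ₑ ≤ w t)
    (hC : ∀ x, ∫⁻ t, ENNReal.ofReal (expKernel (x - t)) * w t ≤ ENNReal.ofReal C) (φ : RTest) :
    ∫ t, (kerConv k φ t : ℂ) * f t = ∫ x, (φ x : ℂ) * funConv k f x := by
  have hφm : AEStronglyMeasurable (fun x => ((φ x : ℝ) : ℂ)) volume :=
    (Complex.continuous_ofReal.comp φ.continuous).aestronglyMeasurable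
  have hint : Integrable (Function.uncurry fun x t : ℝ => (φ x : ℂ) * ((k (x - t) : ℂ) * f t))
      ((volume : Measure ℝ).prod volume) := by
    have hm : AEStronglyMeasurable (Function.uncurry fun x t : ℝ =>
        (φ x : ℂ) * ((k (x - t) : ℂ) * f t)) ((volume : Measure ℝ).prod volume) :=
      hφm.comp_fst.mul (aestronglyMeasurable_kernel_mul hk hf)
    refine ⟨hm, ?_⟩
    have hφi : Integrable φ := φ.continuous.integrable_of_hasCompactSupport φ.hasCompactSupport
    rw [hasFiniteIntegral_iff_enorm, lintegral_prod _ hm.enorm]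
    calc ∫⁻ x, ∫⁻ t, ‖(φ x : ℂ) * ((k (x - t) : ℂ) * f t)‖ₑ
        ≤ ∫⁻ x, ‖φ x‖ₑ * ENNReal.ofReal C := by
          refine lintegral_mono fun x => ?_
          have : ∀ t, ‖(φ x : ℂ) * ((k (x - t) : ℂ) * f t)‖ₑ ≤
              ‖φ x‖ₑ * (ENNReal.ofReal (expKernel (x - t)) * w t) := fun t => by
            rw [enorm_mul, ← ofReal_norm ((φ x : ℝ) : ℂ), Complex.norm_real, ofReal_norm]
            exact mul_le_mul' le_rfl (enorm_kernel_mul_le hk hfw x t)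
          refine (lintegral_mono this).trans ?_
          rw [lintegral_const_mul' _ _ enorm_ne_top]
          exact mul_le_mul' le_rfl (hC x)
      _ < ∞ := by
          rw [lintegral_mul_const' _ _ ENNReal.ofReal_ne_top]
          exact ENNReal.mul_lt_top hφi.2 ENNReal.ofReal_lt_top
  calc ∫ t, (kerConv k φ t : ℂ) * f t
      = ∫ t, ∫ x, (φ x : ℂ) * ((k (x - t) : ℂ) * f t) := by
        refine integral_congr_ae (ae_of_all _ fun t => ?_)
        simp only [kerConv]
        rw [← integral_complex_ofReal, ← integral_mul_const]
        refine integral_congr_ae (ae_of_all _ fun x => ?_)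
        simp only [Complex.ofReal_mul]
        ring
    _ = ∫ x, ∫ t, (φ x : ℂ) * ((k (x - t) : ℂ) * f t) := (integral_integral_swap hint).symm
    _ = ∫ x, (φ x : ℂ) * funConv k f x := by
        simp_rw [integral_const_mul]
        rfl

end FunConv

/-! ### From a representation to the explicit formulas -/

theorem cutoffConv_apply (k : ℝ → ℝ) (hk : LocallyIntegrable k) (η φ : RTest) (t : ℝ) :
    cutoffConv k hk η φ t = η t * kerConv k φ t := rfl

theorem deriv_cutoffConv {k : ℝ → ℝ} (hk : LocallyIntegrable k) (hk' : IsExpBounded k)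
    (η φ : RTest) (t : ℝ) : deriv (cutoffConv k hk η φ) t =
      deriv η t * kerConv k φ t + η t * kerConv k (deriv φ) t :=
  ((differentiable_test η t).hasDerivAt.mul (hasDerivAt_kerConv hk' φ t)).deriv

theorem ConvergesToOne.eventually {η : ℕ → RTest} (h : ConvergesToOne η) (t : ℝ) :
    ∀ᶠ n in atTop, η n t = 1 ∧ deriv (η n) t = 0 := by
  filter_upwards [h.1 (Metric.closedBall t 1) (isCompact_closedBall t 1)] with n hn
  refine ⟨hn t (Metric.mem_closedBall_self zero_le_one), ?_⟩
  have : (η n : ℝ → ℝ) =ᶠ[𝓝 t] fun _ => (1 : ℝ) := by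
    filter_upwards [Metric.closedBall_mem_nhds t one_pos] with x hx using hn x hx
  rw [this.deriv_eq, deriv_const]

theorem ConvergesToOne.exists_bound {η : ℕ → RTest} (h : ConvergesToOne η) :
    ∃ B : ℝ, 0 ≤ B ∧ ∀ n t, |η n t| ≤ B ∧ |deriv (η n) t| ≤ B := by
  obtain ⟨B₀, hB₀⟩ := h.2 0
  obtain ⟨B₁, hB₁⟩ := h.2 1
  simp_rw [iteratedDeriv_zero] at hB₀
  simp_rw [iteratedDeriv_one] at hB₁
  exact ⟨max B₀ B₁, (abs_nonneg _).trans ((hB₀ 0 0).trans (le_max_left _ _)), fun n t =>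
    ⟨(hB₀ n t).trans (le_max_left _ _), (hB₁ n t).trans (le_max_right _ _)⟩⟩

theorem integrable_expKernel_mul {f : ℝ → ℂ} {w : ℝ → ℝ≥0∞} {C : ℝ}
    (hf : AEStronglyMeasurable f volume) (hfw : ∀ t, ‖f t‖ₑ ≤ w t)
    (hC : ∀ x, ∫⁻ t, ENNReal.ofReal (expKernel (x - t)) * w t ≤ ENNReal.ofReal C) :
    Integrable fun t => expKernel t * ‖f t‖ := by
  refine ⟨isExpBounded_expKernel.measurable.aestronglyMeasurable.mul hf.norm, ?_⟩
  rw [hasFiniteIntegral_iff_enorm]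
  refine lt_of_le_of_lt (lintegral_mono fun t => ?_) ((hC 0).trans_lt ENNReal.ofReal_lt_top)
  have h1 : ‖expKernel t‖ = expKernel (0 - t) := by
    rw [expKernel, expKernel, zero_sub, abs_neg, Real.norm_of_nonneg (Real.exp_pos _).le]
  rw [enorm_mul, enorm_norm, ← ofReal_norm (expKernel t), h1]
  exact mul_le_mul' le_rfl (hfw t)

theorem integrable_kerConv_mul {k : ℝ → ℝ} (hk : IsExpBounded k) {f : ℝ → ℂ} {w : ℝ → ℝ≥0∞}
    {C : ℝ} (hf : AEStronglyMeasurable f volume) (hfw : ∀ t, ‖f t‖ₑ ≤ w t)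
    (hC : ∀ x, ∫⁻ t, ENNReal.ofReal (expKernel (x - t)) * w t ≤ ENNReal.ofReal C) (φ : RTest) :
    Integrable fun t => ((kerConv k φ t : ℝ) : ℂ) * f t := by
  have hc : Continuous (kerConv k φ) :=
    continuous_iff_continuousAt.2 fun t => (hasDerivAt_kerConv hk φ t).continuousAt
  refine ((integrable_expKernel_mul hf hfw hC).const_mul (∫ x, Real.exp |x| * |φ x|)).mono'
    ((Complex.continuous_ofReal.comp hc).aestronglyMeasurable.mul hf) (ae_of_all _ fun t => ?_)
  rw [norm_mul, Complex.norm_real, Real.norm_eq_abs, ← mul_assoc]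
  exact mul_le_mul_of_nonneg_right (abs_kerConv_le hk φ.continuous φ.hasCompactSupport t)
    (norm_nonneg _)

/-- Passage to the limit `η_n → 1` in a pairing with a uniformly locally integrable function, on
functions that decay like `e^{-|t|}`. -/
theorem tendsto_integral_of_expDecay {f : ℝ → ℂ} {w : ℝ → ℝ≥0∞} {C : ℝ}
    (hf : AEStronglyMeasurable f volume) (hfw : ∀ t, ‖f t‖ₑ ≤ w t)
    (hC : ∀ x, ∫⁻ t, ENNReal.ofReal (expKernel (x - t)) * w t ≤ ENNReal.ofReal C)
    {u : ℕ → ℝ → ℝ} {v : ℝ → ℝ} {D : ℝ} (hu : ∀ n, Continuous (u n))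
    (hD : ∀ n t, |u n t| ≤ D * expKernel t) (hlim : ∀ t, ∀ᶠ n in atTop, u n t = v t) :
    Tendsto (fun n => ∫ t, (u n t : ℂ) * f t) atTop (𝓝 (∫ t, (v t : ℂ) * f t)) := by
  refine tendsto_integral_of_dominated_convergence (fun t => D * (expKernel t * ‖f t‖))
    (fun n => ((Complex.continuous_ofReal.comp (hu n)).aestronglyMeasurable.mul hf))
    ((integrable_expKernel_mul hf hfw hC).const_mul D) (fun n => ae_of_all _ fun t => ?_)
    (ae_of_all _ fun t => ?_)
  · rw [norm_mul, Complex.norm_real, Real.norm_eq_abs, ← mul_assoc]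
    exact mul_le_mul_of_nonneg_right (hD n t) (norm_nonneg _)
  · refine tendsto_const_nhds.congr' ?_
    filter_upwards [hlim t] with n hn
    rw [hn]

/-- The convolution of `k` with `Γ' + γ` exists, whatever the cut-offs. -/
theorem tendsto_representation_cutoffConv {Γ γ : ℝ → ℂ} (hb : UnifLocBounded Γ γ) {k : ℝ → ℝ}
    (hk : LocallyIntegrable k) (hk' : IsExpBounded k) (φ : RTest) {η : ℕ → RTest}
    (hη : ConvergesToOne η) :
    Tendsto (fun n => (∂_{(1 : ℝ)} (ofFun Γ) + ofFun γ) (cutoffConv k hk (η n) φ)) atTop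
      (𝓝 (-(∫ t, ((kerConv k (deriv φ) t : ℝ) : ℂ) * Γ t) +
        ∫ t, ((kerConv k φ t : ℝ) : ℂ) * γ t)) := by
  obtain ⟨w, M, -, hw, hΓw, hγw, hM⟩ := hb.exists_weight
  obtain ⟨C, -, hC⟩ := exists_lintegral_expKernel_mul_le hw hM
  obtain ⟨B, hB0, hB⟩ := hη.exists_bound
  have hφ := abs_kerConv_le hk' φ.continuous φ.hasCompactSupport
  have hφ' := abs_kerConv_le hk' (continuous_deriv_test φ) φ.hasCompactSupport.deriv
  set D₀ := ∫ x, Real.exp |x| * |φ x|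
  set D₁ := ∫ x, Real.exp |x| * |deriv φ x|
  simp_rw [representation_apply hb]
  refine Tendsto.add (Tendsto.neg ?_) ?_
  · refine tendsto_integral_of_expDecay (D := B * D₀ + B * D₁) hb.1 hΓw hC
      (fun n => continuous_deriv_test _) (fun n t => ?_) (fun t => ?_)
    · rw [deriv_cutoffConv hk hk', add_mul, mul_assoc, mul_assoc]
      refine (abs_add_le _ _).trans (add_le_add ?_ ?_) <;> rw [abs_mul]
      · exact mul_le_mul (hB n t).2 (hφ t) (abs_nonneg _) hB0
      · exact mul_le_mul (hB n t).1 (hφ' t) (abs_nonneg _) hB0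
    · filter_upwards [hη.eventually t] with n hn
      rw [deriv_cutoffConv hk hk', hn.1, hn.2, zero_mul, one_mul, zero_add]
  · refine tendsto_integral_of_expDecay (D := B * D₀) hb.2.1 hγw hC
      (fun n => (cutoffConv k hk (η n) φ).continuous) (fun n t => ?_) (fun t => ?_)
    · rw [cutoffConv_apply, abs_mul, mul_assoc]
      exact mul_le_mul (hB n t).1 (hφ t) (abs_nonneg _) hB0
    · filter_upwards [hη.eventually t] with n hn
      rw [cutoffConv_apply, hn.1, one_mul]

theorem sq_enorm_mul_add_le {c : ℝ} (z b : ℂ) (hb : ‖b‖ ≤ c) :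
    ‖2 * z + b‖ₑ ^ 2 ≤ ENNReal.ofReal 8 * ‖z‖ₑ ^ 2 + ENNReal.ofReal (2 * c ^ 2) := by
  rw [← ofReal_norm, ← ofReal_norm, ← ENNReal.ofReal_pow (norm_nonneg _),
    ← ENNReal.ofReal_pow (norm_nonneg _), ← ENNReal.ofReal_mul (by norm_num),
    ← ENNReal.ofReal_add (by positivity) (by positivity)]
  refine ENNReal.ofReal_le_ofReal ?_
  have h : ‖2 * z + b‖ ≤ 2 * ‖z‖ + c := (norm_add_le _ _).trans (by simpa using hb)
  calc ‖2 * z + b‖ ^ 2 ≤ (2 * ‖z‖ + c) ^ 2 := by gcongr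
    _ ≤ 8 * ‖z‖ ^ 2 + 2 * c ^ 2 := by nlinarith [sq_nonneg (2 * ‖z‖ - c)]

/-- Twice a square integrable function plus a bounded one, together with a bounded function. -/
theorem UnifLocBounded.two_mul_add {Γ γ f g : ℝ → ℂ} (hb : UnifLocBounded Γ γ)
    (hf : AEStronglyMeasurable f volume) (hg : AEStronglyMeasurable g volume) {c : ℝ}
    (hfc : ∀ x, ‖f x‖ ≤ c) (hgc : ∀ x, ‖g x‖ ≤ c) :
    UnifLocBounded (fun x => 2 * Γ x + f x) g := by
  obtain ⟨M, hM0, hM⟩ := hb.lintegral_le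
  refine unifLocBounded_of_le ((hb.1.const_mul 2).add hf) hg (M := ENNReal.ofReal 8 *
    ENNReal.ofReal M + (ENNReal.ofReal (2 * c ^ 2) + ENNReal.ofReal c)) (by finiteness) fun x => ?_
  calc ∫⁻ t in Set.Icc x (x + 1), (‖2 * Γ t + f t‖ₑ ^ 2 + ‖g t‖ₑ)
      ≤ ∫⁻ t in Set.Icc x (x + 1), (ENNReal.ofReal 8 * (‖Γ t‖ₑ ^ 2 + ‖γ t‖ₑ) +
          (ENNReal.ofReal (2 * c ^ 2) + ENNReal.ofReal c)) := by
        refine lintegral_mono fun t => ?_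
        rw [← add_assoc]
        refine add_le_add ((sq_enorm_mul_add_le _ _ (hfc t)).trans ?_) ?_
        · gcongr
          exact le_self_add
        · rw [← ofReal_norm]
          exact ENNReal.ofReal_le_ofReal (hgc t)
    _ ≤ _ := by
        rw [lintegral_add_right _ measurable_const, lintegral_const_mul' _ _ ENNReal.ofReal_ne_top]
        gcongr
        · exact hM x
        · simp

theorem HasRepresentation.explicitBounded {V : Distr} (h : HasRepresentation V) :
    ExplicitBounded V := by
  obtain ⟨Γ, γ, hb, rfl⟩ := h
  obtain ⟨w, M, -, hw, hΓw, hγw, hM⟩ := hb.exists_weight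
  obtain ⟨C, hC0, hC⟩ := exists_lintegral_expKernel_mul_le hw hM
  have hE := isExpBounded_expKernel
  have hS := isExpBounded_signExpKernel
  have hEΓ := aestronglyMeasurable_funConv hE hb.1
  have hSΓ := aestronglyMeasurable_funConv hS hb.1
  have hEγ := aestronglyMeasurable_funConv hE hb.2.1
  have hSγ := aestronglyMeasurable_funConv hS hb.2.1
  have hbound : ∀ f g : ℝ → ℂ, (∀ x, ‖f x‖ ≤ C) → (∀ x, ‖g x‖ ≤ C) → ∀ x, ‖f x - g x‖ ≤ 2 * C :=
    fun f g hf hg x => (norm_sub_le _ _).trans (by linarith [hf x, hg x])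
  have hunif := hb.two_mul_add (hSγ.sub hEΓ) (hEγ.sub hSΓ)
    (hbound _ _ (norm_funConv_le hS hγw hC0 hC) (norm_funConv_le hE hΓw hC0 hC))
    (hbound _ _ (norm_funConv_le hE hγw hC0 hC) (norm_funConv_le hS hΓw hC0 hC))
  have hint : ∀ (φ : RTest) {f : ℝ → ℂ}, LocallyIntegrable f →
      Integrable fun x => ((φ x : ℝ) : ℂ) * f x := fun φ f hf =>
    hf.integrable_smul_left_of_hasCompactSupport (Complex.continuous_ofReal.comp φ.continuous)
      (φ.hasCompactSupport.comp_left Complex.ofReal_zero)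
  have hloc : ∀ {k : ℝ → ℝ} {f : ℝ → ℂ}, IsExpBounded k → AEStronglyMeasurable f volume →
      (∀ t, ‖f t‖ₑ ≤ w t) → LocallyIntegrable (funConv k f) := fun {k f} hk hf hfw =>
    (locallyIntegrable_const C).mono (aestronglyMeasurable_funConv hk hf) (ae_of_all _ fun x => by
      rw [Real.norm_of_nonneg hC0]; exact norm_funConv_le hk hfw hC0 hC x)
  refine ⟨_, _, hunif, fun φ η hη => ?_, fun φ η hη => ?_⟩
  · have key : -(∫ t, ((kerConv signExpKernel (deriv φ) t : ℝ) : ℂ) * Γ t) +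
        ∫ t, ((kerConv signExpKernel φ t : ℝ) : ℂ) * γ t =
        ofFun (fun x => 2 * Γ x + (funConv signExpKernel γ - funConv expKernel Γ) x) φ := by
      have e1 : ∫ t, ((kerConv signExpKernel (deriv φ) t : ℝ) : ℂ) * Γ t =
          -2 * (∫ t, ((φ t : ℝ) : ℂ) * Γ t) + ∫ t, ((kerConv expKernel φ t : ℝ) : ℂ) * Γ t := by
        rw [← integral_const_mul, ← integral_add ((hint φ hb.locallyIntegrable.1).const_mul _)
          (integrable_kerConv_mul hE hb.1 hΓw hC φ)]
        refine integral_congr_ae (ae_of_all _ fun t => ?_)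
        simp only [kerConv_signExpKernel_deriv]
        push_cast
        ring
      have e2 : ∫ x, ((φ x : ℝ) : ℂ) *
          (2 * Γ x + (funConv signExpKernel γ - funConv expKernel Γ) x) =
          2 * (∫ x, ((φ x : ℝ) : ℂ) * Γ x) + ((∫ x, ((φ x : ℝ) : ℂ) * funConv signExpKernel γ x) -
            ∫ x, ((φ x : ℝ) : ℂ) * funConv expKernel Γ x) := by
        have i1 := hint φ (hloc hS hb.2.1 hγw)
        have i2 := hint φ (hloc hE hb.1 hΓw)
        have i3 : Integrable fun x => ((φ x : ℝ) : ℂ) * funConv signExpKernel γ x -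
          ((φ x : ℝ) : ℂ) * funConv expKernel Γ x := i1.sub i2
        rw [← integral_sub i1 i2, ← integral_const_mul,
          ← integral_add ((hint φ hb.locallyIntegrable.1).const_mul 2) i3]
        refine integral_congr_ae (ae_of_all _ fun t => ?_)
        simp only [Pi.sub_apply]
        ring
      rw [ofFun_apply hunif.locallyIntegrable.1, e1, e2, integral_kerConv_mul hE hb.1 hΓw hC,
        integral_kerConv_mul hS hb.2.1 hγw hC]
      ring
    rw [← key]
    exact tendsto_representation_cutoffConv hb locallyIntegrable_signExpKernel hS φ hη
  · have key : -(∫ t, ((kerConv expKernel (deriv φ) t : ℝ) : ℂ) * Γ t) +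
        ∫ t, ((kerConv expKernel φ t : ℝ) : ℂ) * γ t =
        ofFun (funConv expKernel γ - funConv signExpKernel Γ) φ := by
      have e2 : ∫ x, ((φ x : ℝ) : ℂ) * (funConv expKernel γ - funConv signExpKernel Γ) x =
          (∫ x, ((φ x : ℝ) : ℂ) * funConv expKernel γ x) -
            ∫ x, ((φ x : ℝ) : ℂ) * funConv signExpKernel Γ x := by
        rw [← integral_sub (hint φ (hloc hE hb.2.1 hγw)) (hint φ (hloc hS hb.1 hΓw))]
        simp only [Pi.sub_apply, mul_sub]
      simp_rw [kerConv_expKernel_deriv]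
      rw [ofFun_apply hunif.locallyIntegrable.2, e2, integral_kerConv_mul hS hb.1 hΓw hC,
        integral_kerConv_mul hE hb.2.1 hγw hC]
      ring
    rw [← key]
    exact tendsto_representation_cutoffConv hb locallyIntegrable_expKernel hE φ hη

/-! ### From the explicit formulas to a representation -/

/-- Dilations of one cut-off function converge to `1` with all derivatives. -/
theorem exists_convergesToOne : ∃ η : ℕ → RTest, ConvergesToOne η := by
  set f : ContDiffBump (0 : ℝ) := ⟨1, 2, one_pos, one_lt_two⟩ with hf
  have hpos : ∀ n : ℕ, (0 : ℝ) < 1 / ((n : ℝ) + 1) := fun n => by positivity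
  have hfs : ContDiff ℝ ((⊤ : ℕ∞) : WithTop ℕ∞) f := f.contDiff
  refine ⟨fun n => testOf (fun x => f (1 / ((n : ℝ) + 1) * x))
    (hfs.comp (contDiff_const.mul contDiff_id))
    (f.hasCompactSupport.comp_homeomorph (Homeomorph.mulLeft₀ _ (hpos n).ne')), ?_, ?_⟩
  · intro K hK
    obtain ⟨R, hR⟩ := hK.isBounded.exists_norm_le
    obtain ⟨m, hm⟩ := exists_nat_ge R
    filter_upwards [eventually_ge_atTop m] with n hn x hx
    refine f.one_of_mem_closedBall ?_
    rw [mem_closedBall_zero_iff, norm_mul, Real.norm_of_nonneg (hpos n).le, one_div,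
      inv_mul_le_iff₀ (by positivity)]
    have : (m : ℝ) ≤ n := Nat.cast_le.2 hn
    change ‖x‖ ≤ ((n : ℝ) + 1) * 1
    linarith [hR x hx]
  · intro j
    obtain ⟨C, hC⟩ := (f.hasCompactSupport.iteratedFDeriv (𝕜 := ℝ) j).exists_bound_of_continuous
      (hfs.continuous_iteratedFDeriv (m := j) (by exact_mod_cast le_top))
    refine ⟨C, fun n x => ?_⟩
    have h := congrFun (iteratedDeriv_comp_const_mul (n := j) (hfs.of_le (by exact_mod_cast le_top))
      (1 / ((n : ℝ) + 1))) x
    change |iteratedDeriv j (fun x => f (1 / ((n : ℝ) + 1) * x)) x| ≤ C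
    rw [h, abs_mul, abs_of_nonneg (pow_nonneg (hpos n).le j)]
    have h1 : (1 / ((n : ℝ) + 1)) ^ j ≤ 1 := pow_le_one₀ (hpos n).le (by
      rw [div_le_one (by positivity)]; linarith [(Nat.cast_nonneg n : (0 : ℝ) ≤ n)])
    refine (mul_le_of_le_one_left (abs_nonneg _) h1).trans ?_
    rw [← Real.norm_eq_abs, ← norm_iteratedFDeriv_eq_norm_iteratedDeriv]
    exact hC _

/-- `e^{-|·|} * φ - sign e^{-|·|} * φ' = 2 φ`, cut off by a function that equals `1` on the support
of `φ`. -/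
theorem cutoffConv_sub_cutoffConv_lineDeriv (η φ : RTest) (h : ∀ x ∈ tsupport φ, η x = 1) :
    cutoffConv expKernel locallyIntegrable_expKernel η φ -
      cutoffConv signExpKernel locallyIntegrable_signExpKernel η (∂_{(1 : ℝ)} φ) = (2 : ℝ) • φ := by
  ext t
  have hd : ((∂_{(1 : ℝ)} φ : RTest) : ℝ → ℝ) = deriv φ := funext (lineDeriv_test_apply φ)
  change η t * kerConv expKernel φ t -
    η t * kerConv signExpKernel (∂_{(1 : ℝ)} φ : RTest) t = 2 * φ t
  rw [hd, kerConv_signExpKernel_deriv, ← mul_sub]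
  by_cases ht : t ∈ tsupport φ
  · rw [h t ht]; ring
  · rw [image_eq_zero_of_notMem_tsupport ht]; ring

theorem UnifLocBounded.half {Γ γ : ℝ → ℂ} (h : UnifLocBounded Γ γ) :
    UnifLocBounded (fun x => 1 / 2 * Γ x) (fun x => 1 / 2 * γ x) := by
  have h2 : ‖(1 / 2 : ℂ)‖ₑ ≤ 1 := by
    rw [← ofReal_norm, ← ENNReal.ofReal_one]
    exact ENNReal.ofReal_le_ofReal (by norm_num)
  refine ⟨h.1.const_mul _, h.2.1.const_mul _, lt_of_le_of_lt ?_ h.2.2⟩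
  refine iSup_mono fun x => lintegral_mono fun t => ?_
  have h3 : ∀ z : ℂ, ‖1 / 2 * z‖ₑ ≤ ‖z‖ₑ := fun z => by
    rw [enorm_mul]; exact mul_le_of_le_one_left zero_le h2
  gcongr
  · exact h3 _
  · exact h3 _

theorem ExplicitBounded.hasRepresentation {V : Distr} (h : ExplicitBounded V) :
    HasRepresentation V := by
  obtain ⟨Γ, γ, hb, hΓ, hγ⟩ := h
  refine ⟨_, _, hb.half, ?_⟩
  ext φ
  obtain ⟨η, hη⟩ := exists_convergesToOne
  have h1 := (hγ φ η hη).sub (hΓ (∂_{(1 : ℝ)} φ) η hη)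
  have h2 : Tendsto (fun n => V (cutoffConv expKernel locallyIntegrable_expKernel (η n) φ) -
      V (cutoffConv signExpKernel locallyIntegrable_signExpKernel (η n) (∂_{(1 : ℝ)} φ))) atTop
      (𝓝 (2 * V φ)) := by
    refine tendsto_const_nhds.congr' ?_
    filter_upwards [hη.1 _ φ.hasCompactSupport.isCompact] with n hn
    rw [← map_sub, cutoffConv_sub_cutoffConv_lineDeriv _ _ hn, map_smul, Complex.real_smul]
    norm_num
  have h3 := tendsto_nhds_unique h1 h2
  rw [ofFun_apply hb.locallyIntegrable.1, ofFun_apply hb.locallyIntegrable.2] at h3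
  simp_rw [lineDeriv_test_apply] at h3
  rw [representation_apply hb.half]
  simp_rw [mul_left_comm _ (1 / 2 : ℂ), integral_const_mul]
  linear_combination (-1 / 2 : ℂ) * h3

end FormBounded

theorem theorem13 (V : FormBounded.Distr) (η : FormBounded.CTest) (hη : η 0 = 1) :
    List.TFAE
      [FormBounded.InfinitesimallyFormBounded V,
       FormBounded.IsFormBounded V,
       FormBounded.HasRepresentation V,
       FormBounded.ExplicitBounded V,
       FormBounded.MemUnif η V] := by
  tfae_have 1 → 2 := fun h => h.isFormBounded
  tfae_have 2 → 5 := fun h => h.memUnif η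
  tfae_have 5 → 3 := fun h => h.hasRepresentation hη
  tfae_have 3 → 1 := fun h => h.infinitesimallyFormBounded
  tfae_have 3 → 4 := fun h => h.explicitBounded
  tfae_have 4 → 3 := fun h => h.hasRepresentation
  tfae_finish
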